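/- Let $\mu$ be a finite positive Borel measure on $\mathbb{R}$ whose support is compact and infinite. Let $P_n$ be its monic orthogonal polynomials, $p_n=P_n/\|P_n\|_{L^2(\mu)}$ its orthonormal polynomials, and $a_n>0$ ($n\ge 1$) its off-diagonal Jacobi parameters, i.e. $xp_n=a_{n+1}p_{n+1}+b_{n+1}p_n+a_np_{n-1}$ (with $p_{-1}=0$). Let $\nu_n=\frac1n\sum_{j=1}^n\delta_{z_j}$ be the normalized counting measure of the zeros $z_1,\dots,z_n$ of $P_n$ (with multiplicity). Let $H$ be the convex hull of $\operatorname{supp}\mu$ and let $E=\sigma_{\mathrm{ess}}(\mu)$ be the set of nonisolated points of $\operatorname{supp}\mu$. For a finite positive measure $\nu$ of compact support in $\mathbb{C}$ let $\Phi_\nu(z)=\int\log|z-w|^{-1}\,d\nu(w)$ and $\mathcal{E}(\nu)=\int\Phi_\nu\,d\nu$ (values in $(-\infty,\infty]$). Let $C(E)=\exp(-\min\mathcal{E}(\rho))$, the minimum over probability measures $\rho$ on $E$ (so $C(E)=0$ if all these energies are infinite). If $C(E)>0$, let $\rho_E$ be the equilibrium measure of $E$, i.e. the unique minimizer, and let $G_E(z)=-\Phi_{\rho_E}(z)+\log(C(E)^{-1})$.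 (a) Let $n(1)<n(2)<\cdots$ be a sequence in $\{0,1,2,\dots\}$ such that $\nu_{n(j)}$ converges weakly to a measure $\nu_\infty$ and $(a_1\cdots a_{n(j)})^{1/n(j)}\to A$ with $A>0$. Then for every $z\in\mathbb{C}\setminus H$ the potential $\Phi_{\nu_\infty}(z)$ is finite, $$\lim_{j\to\infty}|p_{n(j)}(z)|^{1/n(j)}=A^{-1}\exp(-\Phi_{\nu_\infty}(z))\quad\text{and}\quad \exp(-\Phi_{\nu_\infty}(z))>A .$$ Moreover $A\le C(E)$, and if $A=C(E)$, then $\nu_\infty=\rho_E$. (b) Suppose $C(E)>0$ and $\mu$ is regular, i.e. $\lim_{n\to\infty}(a_1\cdots a_n)^{1/n}=C(E)$. Then $\nu_n$ converges weakly to $\rho_E$, and for every $z\in\mathbb{C}\setminus H$, $G_E(z)$ is finite and $$\lim_{n\to\infty}|p_n(z)|^{1/n}=e^{G_E(z)}.$$ -/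

import Mathlib

open MeasureTheory Filter Topology Polynomial
open scoped ENNReal NNReal

noncomputable section

namespace OPRL

/-! ### Orthogonal polynomials on the real line -/

/-- The monic orthogonal polynomials `P_n` of `μ`, by Gram--Schmidt applied to `1, x, x², …`:
`P_n = x^n - ∑_{k<n} (⟨P_k, x^n⟩ / ‖P_k‖²) P_k` in `L²(μ)`. -/
def monicOP (μ : Measure ℝ) (n : ℕ) : ℝ[X] :=
  X ^ n - ∑ k : Fin n,
    C ((∫ x, (monicOP μ k).eval x * x ^ n ∂μ) / (∫ x, (monicOP μ k).eval x ^ 2 ∂μ)) * monicOP μ k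
termination_by n
decreasing_by all_goals exact k.2

/-- The `L²(μ)` norm of a real polynomial. -/
def l2Norm (μ : Measure ℝ) (Q : ℝ[X]) : ℝ := √(∫ x, Q.eval x ^ 2 ∂μ)

/-- The orthonormal polynomials `p_n = P_n / ‖P_n‖`. -/
def orthonormalP (μ : Measure ℝ) (n : ℕ) : ℝ[X] := C (l2Norm μ (monicOP μ n))⁻¹ * monicOP μ n

/-- The off-diagonal Jacobi parameters: `jacobiA μ k` is `a_{k+1} = ⟨p_k, x p_{k+1}⟩`, the
coefficient of `p_{k+1}` in `x p_k = a_{k+1} p_{k+1} + b_{k+1} p_k + a_k p_{k-1}`. -/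
def jacobiA (μ : Measure ℝ) (k : ℕ) : ℝ :=
  ∫ x, x * (orthonormalP μ k).eval x * (orthonormalP μ (k + 1)).eval x ∂μ

/-- `(a_1 ⋯ a_n)^{1/n}`. -/
def jacobiMean (μ : Measure ℝ) (n : ℕ) : ℝ := (∏ k ∈ Finset.range n, jacobiA μ k) ^ (1 / (n : ℝ))

/-- The unit point mass at `z`. -/
def pointMass (z : ℂ) : FiniteMeasure ℂ := ⟨Measure.dirac z, inferInstance⟩

/-- The zero counting measure `ν_n = (1/n) ∑_j δ_{z_j}`, where `z_1, …, z_n` are the complex zeros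
of `P_n`, counted with multiplicity. -/
def zeroCounting (μ : Measure ℝ) (n : ℕ) : FiniteMeasure ℂ :=
  (n : ℝ≥0)⁻¹ • (((monicOP μ n).map (algebraMap ℝ ℂ)).roots.map pointMass).sum

/-- The essential support `σ_ess(μ)`: the nonisolated points of `supp μ`, as a subset of `ℂ`. -/
def essSupport (μ : Measure ℝ) : Set ℂ :=
  (fun x : ℝ => (x : ℂ)) '' {x ∈ μ.support | AccPt x (𝓟 μ.support)}

/-- The convex hull `H` of `supp μ`, as a subset of `ℂ`. -/
def suppHull (μ : Measure ℝ) : Set ℂ := (fun x : ℝ => (x : ℂ)) '' convexHull ℝ μ.support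

/-! ### Potential theory in the plane -/

/-- The logarithmic kernel `log |z - w|⁻¹`, equal to `+∞` for `z = w`. -/
def logKernel (z w : ℂ) : EReal := ENNReal.log (edist z w)⁻¹

/-- The integral of an extended real valued function, as the integral of its positive part
minus the integral of its negative part (used only when the latter is finite). -/
def extIntegral {α : Type*} [MeasurableSpace α] (ν : Measure α) (f : α → EReal) : EReal :=
  ((∫⁻ x, (f x).toENNReal ∂ν : ℝ≥0∞) : EReal) - ((∫⁻ x, (-f x).toENNReal ∂ν : ℝ≥0∞) : EReal)

/-- The logarithmic potential `Φ_ν(z) = ∫ log |z - w|⁻¹ dν(w)`. -/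
def potential (ν : Measure ℂ) (z : ℂ) : EReal := extIntegral ν (logKernel z)

/-- The Coulomb energy `∬ log |z - w|⁻¹ dν(z) dν(w)`. -/
def energy (ν : Measure ℂ) : EReal := extIntegral (ν.prod ν) fun p => logKernel p.1 p.2

/-- The probability measures on (a closed set) `E`. -/
def probOn (E : Set ℂ) : Set (ProbabilityMeasure ℂ) := {ρ | (ρ : Measure ℂ) Eᶜ = 0}

/-- The least energy of a probability measure on `E`; it is `+∞` if there is none of
finite energy. -/
def minEnergy (E : Set ℂ) : EReal := ⨅ ρ ∈ probOn E, energy (ρ : Measure ℂ)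

/-- The logarithmic capacity `exp (- min energy)` of a compact set `E`, with `exp (-∞) = 0`. -/
def capacity (E : Set ℂ) : ℝ := (EReal.exp (-minEnergy E)).toReal

/-- `ρ` is a probability measure on `E` whose energy is `log (1 / capacity E)`. -/
def IsEquilibriumMeasure (E : Set ℂ) (ρ : ProbabilityMeasure ℂ) : Prop :=
  ρ ∈ probOn E ∧ energy (ρ : Measure ℂ) = minEnergy E

/-- The equilibrium measure of a compact set `E` of positive capacity
(arbitrary if there is no such measure). -/
def equilibriumMeasure (E : Set ℂ) : ProbabilityMeasure ℂ :=
  Classical.epsilon (IsEquilibriumMeasure E)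

/-- The Green's function `G_E(z) = - Φ_{ρ_E}(z) + log (1 / C(E))` of a compact set `E` of positive
capacity. -/
def greenFunction (E : Set ℂ) (z : ℂ) : EReal :=
  -potential (equilibriumMeasure E : Measure ℂ) z + (Real.log (capacity E)⁻¹ : ℝ)

/-- `μ` is regular: `(a_1 ⋯ a_n)^{1/n} → C(σ_ess(μ))`. -/
def IsRegular (μ : Measure ℝ) : Prop :=
  Tendsto (jacobiMean μ) atTop (𝓝 (capacity (essSupport μ)))

end OPRL

end

open scoped ComplexConjugate

namespace OPRL

/-! ### Orthogonality, positivity and Jacobi parameters -/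

section Basics

variable {μ : Measure ℝ}

/-! The zeros are controlled by one orthogonality trick, `not_nonneg_of_factor`: if P_n = S R and
deg T < deg S, then ∫ P_n R T dμ = 0, whereas S T ≥ 0 on supp μ would make ∫ S T R² dμ positive.
Hence all zeros are real and lie in H, and an open interval with at most one point of supp μ carries
at most two of them. After division by n such bounded counts vanish, so a weak limit ν of zero
counting measures is a probability measure on E.

For z off H, (1/n) log |P_n(z)| is the integral of a bounded continuous function against ν_n, and
a_1 ⋯ a_n = ‖P_n‖ / ‖P_0‖; this yields the root limit. The strict bound exp(-Φ_ν(z)) > A says that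
|p_n(z)| grows exponentially, which is `exists_l2Norm_le`: subtract from P_n a polynomial of degree
at most n with the same value at z but exponentially smaller on H, divide by X - z, and use that P_n
is orthogonal to the quotient.

Consequently Φ_ν < -log A off the real line. Fatou's lemma carries the bound down to the line, and
integration gives energy(ν) ≤ -log A (`energy_le_of_potential_le`). Therefore A ≤ C(E), and equality
makes ν a minimizer of the energy.

Minimizers are unique because log(R / |x - y|), for |x - y| ≤ R, is a positive superposition of
products 1_I(x) 1_I(y) over intervals I (`shiftedKernel_eq_lintegral`). Up to a constant the energy
is the squared L² norm of I ↦ ρ(I), and the parallelogram identity applies. For a regular measure,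
every cluster point of ν_n is then ρ_E, and compactness gives convergence. -/

theorem ae_mem_support (μ : Measure ℝ) : ∀ᵐ x ∂μ, x ∈ μ.support := Measure.support_mem_ae

theorem integrable_of_continuous [IsFiniteMeasure μ]
    {F : Type*} [NormedAddCommGroup F] (hcpt : IsCompact μ.support)
    {f : ℝ → F} (hf : Continuous f) : Integrable f μ := by
  have h : μ.restrict μ.support = μ := Measure.restrict_eq_self_of_ae_mem (ae_mem_support μ)
  rw [← h]
  exact hf.continuousOn.integrableOn_compact hcpt

theorem integrable_eval [IsFiniteMeasure μ] (hcpt : IsCompact μ.support) (Q : ℝ[X]) :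
    Integrable (fun x => Q.eval x) μ :=
  integrable_of_continuous hcpt Q.continuous

/-- A nonzero polynomial that is nonnegative on the infinite support has positive integral. -/
theorem integral_eval_pos [IsFiniteMeasure μ]
    (hcpt : IsCompact μ.support) (hinf : μ.support.Infinite)
    {Q : ℝ[X]} (hQ : Q ≠ 0) (hnn : ∀ x ∈ μ.support, 0 ≤ Q.eval x) :
    0 < ∫ x, Q.eval x ∂μ := by
  have hae : 0 ≤ᵐ[μ] fun x => Q.eval x := (ae_mem_support μ).mono hnn
  refine lt_of_le_of_ne (integral_nonneg_of_ae hae) fun h0 => ?_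
  rw [eq_comm, integral_eq_zero_iff_of_nonneg_ae hae (integrable_eval hcpt Q)] at h0
  refine hinf ((Q.roots.toFinset.finite_toSet).subset ?_)
  have hcl : IsClosed {x : ℝ | Q.eval x = 0} := isClosed_eq Q.continuous continuous_const
  refine (Measure.support_subset_of_isClosed hcl h0).trans fun x hx => ?_
  simpa [hQ] using hx

theorem integral_sq_pos [IsFiniteMeasure μ] (hcpt : IsCompact μ.support) (hinf : μ.support.Infinite)
    {Q : ℝ[X]} (hQ : Q ≠ 0) : 0 < ∫ x, Q.eval x ^ 2 ∂μ := by
  simpa using integral_eval_pos hcpt hinf (pow_ne_zero 2 hQ)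
    (fun x _ => by simpa using sq_nonneg (Q.eval x))

/-- Both facts come from one strong induction: the Gram–Schmidt correction has degree below n only
because the earlier degrees are known. -/
theorem monicOP_sub_degree_lt (μ : Measure ℝ) (n : ℕ) :
    (monicOP μ n).Monic ∧ (monicOP μ n).natDegree = n := by
  induction n using Nat.strong_induction_on with
  | _ n ih =>
    rw [monicOP]
    have hlt : (∑ k : Fin n, C ((∫ x, (monicOP μ k).eval x * x ^ n ∂μ) /
        (∫ x, (monicOP μ k).eval x ^ 2 ∂μ)) * monicOP μ k).degree < (n : WithBot ℕ) := by
      refine (Polynomial.degree_sum_le _ _).trans_lt ?_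
      refine (Finset.sup_lt_iff (WithBot.bot_lt_coe n)).2 fun k _ => ?_
      rw [← smul_eq_C_mul]
      refine (degree_smul_le _ _).trans_lt ?_
      rw [degree_eq_natDegree (ih k k.2).1.ne_zero, (ih k k.2).2]
      exact Nat.cast_lt.2 k.2
    rw [sub_eq_add_neg]
    have hlt' := (degree_neg _).trans_lt hlt
    refine ⟨monic_X_pow_add hlt', ?_⟩
    rw [natDegree_add_eq_left_of_degree_lt (by simpa using hlt)]
    simp

theorem monicOP_monic (μ : Measure ℝ) (n : ℕ) : (monicOP μ n).Monic := (monicOP_sub_degree_lt μ n).1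

theorem natDegree_monicOP (μ : Measure ℝ) (n : ℕ) : (monicOP μ n).natDegree = n :=
  (monicOP_sub_degree_lt μ n).2

theorem degree_monicOP (μ : Measure ℝ) (n : ℕ) : (monicOP μ n).degree = n := by
  rw [degree_eq_natDegree (monicOP_monic μ n).ne_zero, natDegree_monicOP]

theorem integral_monicOP_mul_monicOP [IsFiniteMeasure μ]
    (hcpt : IsCompact μ.support) (hinf : μ.support.Infinite)
    (n : ℕ) : ∀ j < n, ∫ x, (monicOP μ n).eval x * (monicOP μ j).eval x ∂μ = 0 := by
  induction n using Nat.strong_induction_on with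
  | _ n ih =>
    intro j hj
    have hint : ∀ Q : ℝ[X], Integrable (fun x => Q.eval x) μ := integrable_eval hcpt
    have key : ∀ x, (monicOP μ n).eval x * (monicOP μ j).eval x = (monicOP μ j).eval x * x ^ n -
        ∑ k : Fin n, ((∫ x, (monicOP μ k).eval x * x ^ n ∂μ) /
        (∫ x, (monicOP μ k).eval x ^ 2 ∂μ)) * ((monicOP μ k).eval x * (monicOP μ j).eval x) := by
      intro x
      rw [monicOP]
      simp only [eval_sub, eval_pow, eval_X, eval_finsetSum, eval_mul, eval_C, sub_mul,
        Finset.sum_mul, mul_assoc]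
      ring
    have hi1 : Integrable (fun x => (monicOP μ j).eval x * x ^ n) μ := integrable_of_continuous hcpt (by fun_prop)
    have hi2 : ∀ k : Fin n, Integrable (fun x => ((∫ x, (monicOP μ k).eval x * x ^ n ∂μ) /
        (∫ x, (monicOP μ k).eval x ^ 2 ∂μ)) * ((monicOP μ k).eval x * (monicOP μ j).eval x)) μ :=
      fun k => by simpa using (hint (monicOP μ k * monicOP μ j)).const_mul _
    simp_rw [key]
    rw [integral_sub hi1 (integrable_finsetSum _ fun k _ => hi2 k),
      integral_finsetSum _ fun k _ => hi2 k, Finset.sum_eq_single (⟨j, hj⟩ : Fin n)]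
    · rw [integral_const_mul]
      have := (integral_sq_pos hcpt hinf (monicOP_monic μ j).ne_zero).ne'
      simp only [← pow_two]
      field_simp
      ring
    · intro k _ hk
      rw [integral_const_mul]
      have hkj : (k : ℕ) ≠ j := fun h => hk (Fin.ext h)
      rcases lt_or_gt_of_ne hkj with h | h
      · have := ih j hj k h
        simp only [mul_comm ((monicOP μ j).eval _)] at this
        rw [this, mul_zero]
      · rw [ih k k.2 j h, mul_zero]
    · simp

/-- `P_n` is orthogonal to all polynomials of degree less than `n`. -/
theorem integral_monicOP_mul [IsFiniteMeasure μ]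
    (hcpt : IsCompact μ.support) (hinf : μ.support.Infinite)
    {n : ℕ} {Q : ℝ[X]} (hQ : Q.degree < n) : ∫ x, (monicOP μ n).eval x * Q.eval x ∂μ = 0 := by
  have hint : ∀ Q : ℝ[X], Integrable (fun x => Q.eval x) μ := integrable_eval hcpt
  suffices H : ∀ d ≤ n, ∀ Q : ℝ[X], Q.degree < d →
      ∫ x, (monicOP μ n).eval x * Q.eval x ∂μ = 0 from H n le_rfl Q hQ
  intro d
  induction d with
  | zero =>
    intro _ Q hQ
    have : Q = 0 := by
      rw [← degree_eq_bot]
      simpa using hQ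
    simp [this]
  | succ d ih =>
    intro hd Q hQ
    -- Since P_d is monic of degree d, this removes the coefficient of x^d and lowers the degree.
    set Q' := Q - C (Q.coeff d) * monicOP μ d with hQ'
    have hdeg : Q'.degree < d := by
      rw [degree_lt_iff_coeff_zero]
      intro m hm
      rcases hm.eq_or_lt with rfl | hm
      · have h := (monicOP_monic μ d).coeff_natDegree
        rw [natDegree_monicOP] at h
        simp [hQ', h]
      · have h1 : Q.coeff m = 0 := (degree_lt_iff_coeff_zero _ _).1 hQ m (by exact_mod_cast hm)
        have h2 : (monicOP μ d).coeff m = 0 :=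
          coeff_eq_zero_of_natDegree_lt (by rwa [natDegree_monicOP])
        simp [hQ', h1, h2]
    have hdec : ∀ x, (monicOP μ n).eval x * Q.eval x = (monicOP μ n).eval x * Q'.eval x +
        Q.coeff d * ((monicOP μ n).eval x * (monicOP μ d).eval x) := by
      intro x
      simp [hQ']
      ring
    simp_rw [hdec]
    rw [integral_add (by simpa using hint (monicOP μ n * Q'))
      (by simpa using (hint (monicOP μ n * monicOP μ d)).const_mul _), integral_const_mul,
      ih (by omega) Q' hdeg, integral_monicOP_mul_monicOP hcpt hinf n d (by omega)]
    simp

theorem l2Norm_pos [IsFiniteMeasure μ] (hcpt : IsCompact μ.support) (hinf : μ.support.Infinite)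
    {Q : ℝ[X]} (hQ : Q ≠ 0) : 0 < l2Norm μ Q :=
  Real.sqrt_pos.2 (integral_sq_pos hcpt hinf hQ)

theorem l2Norm_sq (Q : ℝ[X]) : l2Norm μ Q ^ 2 = ∫ x, Q.eval x ^ 2 ∂μ :=
  Real.sq_sqrt (integral_nonneg fun _ => sq_nonneg _)

/-- The polynomial x P_k - P_{k+1} has degree at most k, so it is orthogonal to P_{k+1} and ⟨x P_k,
P_{k+1}⟩ = ‖P_{k+1}‖². -/
theorem jacobiA_eq [IsFiniteMeasure μ]
    (hcpt : IsCompact μ.support) (hinf : μ.support.Infinite) (k : ℕ) :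
    jacobiA μ k = l2Norm μ (monicOP μ (k + 1)) / l2Norm μ (monicOP μ k) := by
  have hint : ∀ Q : ℝ[X], Integrable (fun x => Q.eval x) μ := integrable_eval hcpt
  have hp0 := l2Norm_pos hcpt hinf (monicOP_monic μ k).ne_zero
  have hp1 := l2Norm_pos hcpt hinf (monicOP_monic μ (k + 1)).ne_zero
  have hdeg : (X * monicOP μ k - monicOP μ (k + 1)).degree < ((k + 1 : ℕ) : WithBot ℕ) := by
    have hm : (X * monicOP μ k).Monic := monic_X.mul (monicOP_monic μ k)
    have hd : (X * monicOP μ k).degree = ((k + 1 : ℕ) : WithBot ℕ) := by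
      rw [degree_mul, degree_X, degree_monicOP]
      push_cast
      ring
    rw [← hd]
    refine degree_sub_lt_left (by rw [hd, degree_monicOP]) hm.ne_zero ?_
    rw [hm.leadingCoeff, (monicOP_monic μ (k + 1)).leadingCoeff]
  have h0 := integral_monicOP_mul hcpt hinf hdeg
  have hdec : ∀ x, x * (orthonormalP μ k).eval x * (orthonormalP μ (k + 1)).eval x =
      ((l2Norm μ (monicOP μ k))⁻¹ * (l2Norm μ (monicOP μ (k + 1)))⁻¹) *
      ((monicOP μ (k + 1)).eval x * (X * monicOP μ k - monicOP μ (k + 1)).eval x +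
        (monicOP μ (k + 1)).eval x ^ 2) := by
    intro x
    simp [orthonormalP]
    ring
  rw [jacobiA]
  simp_rw [hdec]
  rw [integral_const_mul, integral_add
    (integrable_of_continuous hcpt (by fun_prop))
    (integrable_of_continuous hcpt (by fun_prop)), h0, ← l2Norm_sq]
  field_simp
  ring

/-- The quotients telescope. The factor ‖P_0‖ remains because μ need not be normalized; it
disappears after taking n-th roots. -/
theorem prod_jacobiA [IsFiniteMeasure μ]
    (hcpt : IsCompact μ.support) (hinf : μ.support.Infinite) (n : ℕ) :
    ∏ k ∈ Finset.range n, jacobiA μ k = l2Norm μ (monicOP μ n) / l2Norm μ (monicOP μ 0) := by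
  have hp : ∀ k, l2Norm μ (monicOP μ k) ≠ 0 := fun k =>
    (l2Norm_pos hcpt hinf (monicOP_monic μ k).ne_zero).ne'
  simp_rw [jacobiA_eq hcpt hinf]
  induction n with
  | zero => simp [hp 0]
  | succ n ih =>
    rw [Finset.prod_range_succ, ih]
    have := hp 0
    have := hp n
    field_simp

/-- If `P_n = S R` and `T` has smaller degree than `S`, then `S T` cannot be nonnegative on the
support. -/
theorem not_nonneg_of_factor [IsFiniteMeasure μ]
    (hcpt : IsCompact μ.support) (hinf : μ.support.Infinite) {n : ℕ}
    {S R T : ℝ[X]} (h : monicOP μ n = S * R) (hT : T ≠ 0) (hdeg : T.degree < S.degree)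
    (hnn : ∀ x ∈ μ.support, 0 ≤ S.eval x * T.eval x) : False := by
  have hne : S * R ≠ 0 := h ▸ (monicOP_monic μ n).ne_zero
  have hS : S ≠ 0 := left_ne_zero_of_mul hne
  have hR : R ≠ 0 := right_ne_zero_of_mul hne
  have h1 : (R * T).degree < n := by
    rw [← degree_monicOP μ n, h, degree_mul, degree_mul, add_comm]
    exact WithBot.add_lt_add_right (by simpa using hR) hdeg
  have h2 := integral_monicOP_mul hcpt hinf h1
  have h3 := integral_eval_pos hcpt hinf (Q := (S * T) * R ^ 2)
    (mul_ne_zero (mul_ne_zero hS hT) (pow_ne_zero 2 hR)) (fun x hx => by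
      simpa using mul_nonneg (hnn x hx) (sq_nonneg (R.eval x)))
  refine h3.ne' ?_
  rw [← h2]
  congr 1
  ext x
  rw [h]
  simp
  ring

end Basics


/-! ### Location of the zeros -/

section Zeros

variable {μ : Measure ℝ}

/-- The complex zeros of `P_n`, with multiplicity. -/
noncomputable def zeros (μ : Measure ℝ) (n : ℕ) : Multiset ℂ :=
  ((monicOP μ n).map (algebraMap ℝ ℂ)).roots

theorem map_monicOP_ne_zero (μ : Measure ℝ) (n : ℕ) :
    (monicOP μ n).map (algebraMap ℝ ℂ) ≠ 0 :=
  ((monicOP_monic μ n).map _).ne_zero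

theorem aeval_eq_zero_of_mem_zeros {n : ℕ} {z : ℂ} (hz : z ∈ zeros μ n) :
    aeval z (monicOP μ n) = 0 := by
  have := (mem_roots (map_monicOP_ne_zero μ n)).1 hz
  rwa [IsRoot, eval_map_algebraMap] at this

theorem card_zeros (μ : Measure ℝ) (n : ℕ) : (zeros μ n).card = n := by
  rw [zeros, ← (IsAlgClosed.splits _).natDegree_eq_card_roots, natDegree_map, natDegree_monicOP]

theorem prod_zeros (μ : Measure ℝ) (n : ℕ) (z : ℂ) :
    aeval z (monicOP μ n) = ((zeros μ n).map fun w => z - w).prod := by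
  have h := (IsAlgClosed.splits ((monicOP μ n).map (algebraMap ℝ ℂ))).eq_prod_roots
  rw [((monicOP_monic μ n).map (algebraMap ℝ ℂ)).leadingCoeff, C_1, one_mul] at h
  rw [← eval_map_algebraMap, h, eval_multiset_prod, Multiset.map_map]
  simp [zeros]

theorem im_eq_zero_of_mem_zeros [IsFiniteMeasure μ]
    (hcpt : IsCompact μ.support) (hinf : μ.support.Infinite)
    {n : ℕ} {z : ℂ} (hz : z ∈ zeros μ n) : z.im = 0 := by
  by_contra him
  obtain ⟨R, hR⟩ := quadratic_dvd_of_aeval_eq_zero_im_ne_zero _ (aeval_eq_zero_of_mem_zeros hz) him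
  refine not_nonneg_of_factor hcpt hinf hR (T := 1) one_ne_zero ?_ fun x _ => ?_
  · rw [degree_one]
    have : (X ^ 2 - C (2 * z.re) * X + C (‖z‖ ^ 2) : ℝ[X]).degree = 2 := by
      compute_degree!
    rw [this]
    norm_num
  · have : ‖z‖ ^ 2 = z.re ^ 2 + z.im ^ 2 := by
      rw [← Complex.normSq_eq_norm_sq, Complex.normSq_apply]
      ring
    simp only [eval_add, eval_sub, eval_pow, eval_X, eval_mul, eval_C, eval_one, mul_one, this]
    nlinarith [sq_nonneg (x - z.re), sq_nonneg z.im]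

theorem re_mem_convexHull_of_mem_zeros [IsFiniteMeasure μ]
    (hcpt : IsCompact μ.support) (hinf : μ.support.Infinite)
    {n : ℕ} {z : ℂ} (hz : z ∈ zeros μ n) : z.re ∈ convexHull ℝ μ.support := by
  by_contra hcon
  have him := im_eq_zero_of_mem_zeros hcpt hinf hz
  have hzr : z = (z.re : ℂ) := Complex.ext (by simp) (by simp [him])
  have h0 := aeval_eq_zero_of_mem_zeros hz
  rw [hzr, ← Complex.coe_algebraMap, aeval_algebraMap_apply] at h0
  have h0' : (monicOP μ n).IsRoot z.re := by
    simpa using h0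
  obtain ⟨R, hR⟩ := dvd_iff_isRoot.2 h0'
  have hc : ∀ x ∈ μ.support, ∀ y ∈ μ.support, x ≤ z.re → z.re ≤ y → False := by
    intro x hx y hy h1 h2
    refine hcon (segment_subset_convexHull hx hy ?_)
    rw [segment_eq_Icc (h1.trans h2)]
    exact ⟨h1, h2⟩
  by_cases hex : ∃ x ∈ μ.support, x ≤ z.re
  · obtain ⟨x, hx, hxz⟩ := hex
    -- The support lies on one side of a zero outside the hull, so X - z has constant sign there; T
    -- only adjusts the sign.
    refine not_nonneg_of_factor hcpt hinf hR (T := C (-1)) (by simp) ?_ fun y hy => ?_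
    · rw [degree_X_sub_C, degree_C (by norm_num)]
      norm_num
    · have : y ≤ z.re := by
        by_contra hlt
        exact hc x hx y hy hxz (not_le.1 hlt).le
      simp
      linarith
  · push Not at hex
    refine not_nonneg_of_factor hcpt hinf hR (T := 1) one_ne_zero ?_ fun y hy => ?_
    · rw [degree_X_sub_C, degree_one]
      norm_num
    · simpa using (hex y hy).le

theorem mem_suppHull_of_mem_zeros [IsFiniteMeasure μ]
    (hcpt : IsCompact μ.support) (hinf : μ.support.Infinite)
    {n : ℕ} {z : ℂ} (hz : z ∈ zeros μ n) : z ∈ suppHull μ :=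
  ⟨z.re, re_mem_convexHull_of_mem_zeros hcpt hinf hz,
    Complex.ext (by simp) (by simp [im_eq_zero_of_mem_zeros hcpt hinf hz])⟩

/-- An open interval with at most one point of the support contains at most two zeros. -/
theorem card_zeros_filter_le [IsFiniteMeasure μ]
    (hcpt : IsCompact μ.support) (hinf : μ.support.Infinite)
    (n : ℕ) {a b x₀ : ℝ} (hx₀ : x₀ ∈ Set.Ioo a b) (hI : μ.support ∩ Set.Ioo a b ⊆ {x₀}) :
    ((zeros μ n).filter fun z => z.re ∈ Set.Ioo a b).card ≤ 2 := by
  classical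
  by_contra! hcard
  obtain ⟨s, hs'⟩ := Multiset.card_pos_iff_exists_mem.1
    ((Nat.choose_pos hcard).trans_eq (Multiset.card_powersetCard 3 _).symm)
  obtain ⟨hs, hs3⟩ := Multiset.mem_powersetCard.1 hs'
  obtain ⟨r₁, r₂, r₃, rfl⟩ := Multiset.card_eq_three.1 hs3
  have hmem : ∀ r ∈ ({r₁, r₂, r₃} : Multiset ℂ), r ∈ zeros μ n ∧ r.re ∈ Set.Ioo a b := fun r hr =>
    Multiset.mem_filter.1 (Multiset.mem_of_le hs hr)
  have hreal : ∀ r ∈ ({r₁, r₂, r₃} : Multiset ℂ), ((r.re : ℝ) : ℂ) = r := fun r hr =>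
    Complex.ext (by simp) (by simp [im_eq_zero_of_mem_zeros hcpt hinf (hmem r hr).1])
  have e₁ := hreal r₁ (by simp)
  have e₂ := hreal r₂ (by simp)
  have e₃ := hreal r₃ (by simp)
  obtain ⟨-, l₁, u₁⟩ := hmem r₁ (by simp)
  obtain ⟨-, l₂, u₂⟩ := hmem r₂ (by simp)
  obtain ⟨-, l₃, u₃⟩ := hmem r₃ (by simp)
  have hdvd := (Multiset.prod_X_sub_C_dvd_iff_le_roots (map_monicOP_ne_zero μ n) _).2
    (hs.trans (Multiset.filter_le _ _))
  set S : ℝ[X] := (X - C r₁.re) * ((X - C r₂.re) * (X - C r₃.re)) with hS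
  have hmap : (({r₁, r₂, r₃} : Multiset ℂ).map fun a => X - C a).prod =
      S.map (algebraMap ℝ ℂ) := by
    simp [hS, e₁, e₂, e₃]
  rw [hmap, map_dvd_map'] at hdvd
  obtain ⟨R, hR⟩ := hdvd
  -- The product of the three zero factors with X - x₀ vanishes at the only possible support point
  -- in the interval. Outside it, all four factors have the same sign.
  refine not_nonneg_of_factor hcpt hinf hR (T := X - C x₀) (X_sub_C_ne_zero _) ?_ fun x hx => ?_
  · simp only [hS, degree_mul, degree_X_sub_C]
    norm_num
  · simp only [hS, eval_mul, eval_sub, eval_X, eval_C]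
    by_cases hxI : x ∈ Set.Ioo a b
    · have : x = x₀ := hI ⟨hx, hxI⟩
      simp [this]
    · rw [Set.mem_Ioo, not_and_or, not_lt, not_lt] at hxI
      rcases hxI with hxa | hxb
      · have h := mul_nonneg (mul_nonneg (sub_nonneg.2 (hxa.trans l₁.le))
          (sub_nonneg.2 (hxa.trans l₂.le))) (mul_nonneg (sub_nonneg.2 (hxa.trans l₃.le))
          (sub_nonneg.2 (hxa.trans hx₀.1.le)))
        linarith
      · have h := mul_nonneg (mul_nonneg (sub_nonneg.2 (u₁.le.trans hxb))
          (sub_nonneg.2 (u₂.le.trans hxb))) (mul_nonneg (sub_nonneg.2 (u₃.le.trans hxb))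
          (sub_nonneg.2 (hx₀.2.le.trans hxb)))
        linarith

end Zeros

/-! ### Integration against the zero counting measure -/

section Counting

theorem integral_sum_pointMass (s : Multiset ℂ) (f : ℂ → ℝ) :
    Integrable f ((s.map pointMass).sum : FiniteMeasure ℂ) ∧
    ∫ w, f w ∂((s.map pointMass).sum : FiniteMeasure ℂ) = (s.map f).sum := by
  induction s using Multiset.induction_on with
  | empty => simp
  | cons a s ih =>
    have h1 : Integrable f (pointMass a : Measure ℂ) := integrable_dirac (by simp)
    have h2 : ∫ w, f w ∂(pointMass a : Measure ℂ) = f a := integral_dirac f a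
    simp only [Multiset.map_cons, Multiset.sum_cons, FiniteMeasure.toMeasure_add]
    exact ⟨h1.add_measure ih.1, by rw [integral_add_measure h1 ih.1, h2, ih.2]⟩

theorem integral_zeroCounting (μ : Measure ℝ) (n : ℕ) (f : ℂ → ℝ) :
    ∫ w, f w ∂(zeroCounting μ n : Measure ℂ) = (n : ℝ)⁻¹ * ((zeros μ n).map f).sum := by
  rw [zeroCounting, FiniteMeasure.toMeasure_smul, integral_smul_nnreal_measure,
    (integral_sum_pointMass _ f).2]
  simp [NNReal.smul_def, zeros]

end Counting

/-! ### Weak limits live on the essential support -/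

section WeakLimit

variable {μ : Measure ℝ} {n : ℕ → ℕ} {l : Filter ℕ} {ν : FiniteMeasure ℂ}

theorem tendsto_sum_zeros (hν : Tendsto (fun j => zeroCounting μ (n j)) l (𝓝 ν))
    (f : BoundedContinuousFunction ℂ ℝ) :
    Tendsto (fun j => (n j : ℝ)⁻¹ * ((zeros μ (n j)).map f).sum) l (𝓝 (∫ w, f w ∂ν)) := by
  have := FiniteMeasure.tendsto_iff_forall_integral_tendsto.1 hν f
  simpa only [integral_zeroCounting] using this

theorem measure_univ_weakLimit [l.NeBot] (hn : Tendsto n l atTop)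
    (hν : Tendsto (fun j => zeroCounting μ (n j)) l (𝓝 ν)) : (ν : Measure ℂ) Set.univ = 1 := by
  have h := tendsto_sum_zeros hν (BoundedContinuousFunction.const ℂ 1)
  have h1 : Tendsto (fun j => (n j : ℝ)⁻¹ * ((zeros μ (n j)).map
      (BoundedContinuousFunction.const ℂ (1 : ℝ))).sum) l (𝓝 1) := by
    refine tendsto_const_nhds.congr' ?_
    filter_upwards [hn.eventually_gt_atTop 0] with j hj
    have : (n j : ℝ) ≠ 0 := by positivity
    simp [Multiset.map_const', card_zeros, this]
  have h2 := tendsto_nhds_unique h h1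
  simp only [BoundedContinuousFunction.const_apply, integral_const, smul_eq_mul, mul_one,
    measureReal_def] at h2
  rw [← ENNReal.ofReal_toReal (measure_ne_top (ν : Measure ℂ) Set.univ), h2, ENNReal.ofReal_one]

/-- A sum over the zeros that stays bounded in n has average tending to zero, so a nonnegative test
function integrates to zero in the limit. -/
theorem ae_eq_zero_of_sum_zeros_le [l.NeBot] (hn : Tendsto n l atTop)
    (hν : Tendsto (fun j => zeroCounting μ (n j)) l (𝓝 ν))
    (f : BoundedContinuousFunction ℂ ℝ) (hf : ∀ w, 0 ≤ f w) {c : ℝ}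
    (hc : ∀ m, ((zeros μ m).map f).sum ≤ c) : ∀ᵐ w ∂(ν : Measure ℂ), f w = 0 := by
  have h := tendsto_sum_zeros hν f
  have h0 : Tendsto (fun j => (n j : ℝ)⁻¹ * c) l (𝓝 0) := by
    simpa using ((tendsto_natCast_atTop_atTop.comp hn).inv_tendsto_atTop).mul_const c
  have hle : ∫ w, f w ∂(ν : Measure ℂ) ≤ 0 :=
    le_of_tendsto_of_tendsto' h h0 fun j => mul_le_mul_of_nonneg_left (hc _) (by positivity)
  have h1 := (integral_eq_zero_iff_of_nonneg (fun w => hf w) (f.integrable _)).1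
    (le_antisymm hle (integral_nonneg hf))
  exact h1

theorem measure_compl_essSupport [IsFiniteMeasure μ]
    [l.NeBot] (hcpt : IsCompact μ.support) (hinf : μ.support.Infinite)
    (hn : Tendsto n l atTop)
    (hν : Tendsto (fun j => zeroCounting μ (n j)) l (𝓝 ν)) :
    (ν : Measure ℂ) (essSupport μ)ᶜ = 0 := by
  refine measure_null_of_locally_null _ fun w hw => ?_
  by_cases him : w.im = 0
  · have hacc : ∃ U ∈ 𝓝 w.re, μ.support ∩ U ⊆ {w.re} := by
      by_contra! hcon
      refine hw ⟨w.re, ⟨?_, ?_⟩, Complex.ext (by simp) (by simp [him])⟩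
      · by_contra hns
        refine hcon _ (Measure.isOpen_compl_support.mem_nhds hns) ?_
        simp
      · rw [accPt_iff_nhds]
        intro U hU
        obtain ⟨y, hy, hne⟩ := Set.not_subset.1 (hcon U hU)
        exact ⟨y, ⟨hy.2, hy.1⟩, hne⟩
    obtain ⟨U, hU, hUs⟩ := hacc
    obtain ⟨a, b, hab, habU⟩ := mem_nhds_iff_exists_Ioo_subset.1 hU
    -- A bump that is positive exactly on the strip over (a, b) and at most 1, so its sum over the
    -- zeros is at most their number in the strip.
    let g : ℂ → ℝ := fun z => max 0 (min 1 (min (z.re - a) (b - z.re)))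
    have hg : Continuous g := by fun_prop
    have hg0 : ∀ z, 0 ≤ g z := fun z => le_max_left _ _
    have hg1 : ∀ z, g z ≤ 1 := fun z => max_le zero_le_one (min_le_left _ _)
    let f : BoundedContinuousFunction ℂ ℝ := BoundedContinuousFunction.ofNormedAddCommGroup g hg 1
      fun z => by rw [Real.norm_of_nonneg (hg0 z)]; exact hg1 z
    have hae := ae_eq_zero_of_sum_zeros_le hn hν f hg0 (c := 2) fun m => by
      classical
      have hcard := card_zeros_filter_le hcpt hinf m hab
        ((Set.inter_subset_inter_right _ habU).trans hUs)
      have hle : ((zeros μ m).map f).sum ≤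
          ((zeros μ m).map fun z => if z.re ∈ Set.Ioo a b then (1 : ℝ) else 0).sum := by
        refine Multiset.sum_map_le_sum_map _ _ fun z _ => ?_
        change g z ≤ _
        split_ifs with h
        · exact hg1 z
        · refine max_le le_rfl ((min_le_right _ _).trans ?_)
          rw [Set.mem_Ioo, not_and_or, not_lt, not_lt] at h
          rcases h with h | h
          · exact (min_le_left _ _).trans (by linarith)
          · exact (min_le_right _ _).trans (by linarith)
      refine hle.trans ?_
      have : ((zeros μ m).map fun z => if z.re ∈ Set.Ioo a b then (1 : ℝ) else 0).sum =
          (((zeros μ m).filter fun z => z.re ∈ Set.Ioo a b).card : ℝ) := by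
        induction zeros μ m using Multiset.induction_on with
        | empty => simp
        | cons z s ih =>
          rw [Multiset.map_cons, Multiset.sum_cons, ih, Multiset.filter_cons]
          split_ifs <;> simp [add_comm]
      rw [this]
      exact_mod_cast hcard
    refine ⟨{z | z.re ∈ Set.Ioo a b}, mem_nhdsWithin_of_mem_nhds
      ((isOpen_Ioo.preimage Complex.continuous_re).mem_nhds hab), ?_⟩
    refine measure_mono_null (fun z hz => ?_) hae
    have h1 : 0 < min 1 (min (z.re - a) (b - z.re)) :=
      lt_min one_pos (lt_min (by linarith [hz.1]) (by linarith [hz.2]))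
    exact (lt_max_of_lt_right h1).ne'
  · let g : ℂ → ℝ := fun z => min 1 |z.im|
    have hg : Continuous g := by fun_prop
    have hg0 : ∀ z, 0 ≤ g z := fun z => le_min zero_le_one (abs_nonneg _)
    let f : BoundedContinuousFunction ℂ ℝ := BoundedContinuousFunction.ofNormedAddCommGroup g hg 1
      fun z => by rw [Real.norm_of_nonneg (hg0 z)]; exact min_le_left _ _
    have hae := ae_eq_zero_of_sum_zeros_le hn hν f hg0 (c := 0) fun m => by
      refine (Multiset.sum_eq_zero fun x hx => ?_).le
      obtain ⟨z, hz, rfl⟩ := Multiset.mem_map.1 hx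
      change g z = 0
      simp [g, im_eq_zero_of_mem_zeros hcpt hinf hz]
    refine ⟨{z | z.im ≠ 0}, mem_nhdsWithin_of_mem_nhds
      ((isOpen_ne_fun Complex.continuous_im continuous_const).mem_nhds him), ?_⟩
    refine measure_mono_null (fun z hz => ?_) hae
    exact (lt_min one_pos (abs_pos.2 hz)).ne'

end WeakLimit


/-! ### Exponential growth off the convex hull -/

section LowerBound

variable {μ : Measure ℝ}

theorem isCompact_convexHull_real {s : Set ℝ} (hs : IsCompact s) : IsCompact (convexHull ℝ s) := by
  rcases s.eq_empty_or_nonempty with rfl | hne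
  · simp
  have hle : sInf s ≤ sSup s := Real.sInf_le_sSup s hs.bddBelow hs.bddAbove
  have : convexHull ℝ s = Set.Icc (sInf s) (sSup s) := by
    refine Set.Subset.antisymm (convexHull_min (fun x hx =>
      ⟨csInf_le hs.bddBelow hx, le_csSup hs.bddAbove hx⟩) (convex_Icc _ _)) ?_
    rw [← segment_eq_Icc hle]
    exact segment_subset_convexHull (hs.sInf_mem hne) (hs.sSup_mem hne)
  rw [this]
  exact isCompact_Icc

theorem isCompact_suppHull (hcpt : IsCompact μ.support) : IsCompact (suppHull μ) :=
  (isCompact_convexHull_real hcpt).image Complex.continuous_ofReal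

theorem convex_suppHull (μ : Measure ℝ) : Convex ℝ (suppHull μ) :=
  (convex_convexHull ℝ μ.support).is_linear_image Complex.ofRealCLM.isBoundedLinearMap.toIsLinearMap

theorem ofReal_mem_suppHull {x : ℝ} (hx : x ∈ μ.support) : (x : ℂ) ∈ suppHull μ :=
  ⟨x, subset_convexHull ℝ _ hx, rfl⟩

theorem essSupport_subset_suppHull (μ : Measure ℝ) : essSupport μ ⊆ suppHull μ := by
  rintro _ ⟨x, hx, rfl⟩
  exact ofReal_mem_suppHull hx.1

/-- Quantitative separation of a point from the convex hull of the support. -/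
theorem exists_separation (hcpt : IsCompact μ.support) {z : ℂ} (hz : z ∉ suppHull μ) :
    ∃ (θ : ℂ) (d δ D : ℝ), 0 < d ∧ 0 < δ ∧ δ ≤ D ∧ ∀ w ∈ suppHull μ,
      d ≤ (conj θ * (w - z)).re ∧ δ ≤ ‖w - z‖ ∧ ‖w - z‖ ≤ D := by
  have hK := isCompact_suppHull hcpt
  obtain ⟨f, u, hfz, hfK⟩ := geometric_hahn_banach_point_closed (convex_suppHull μ) hK.isClosed hz
  obtain ⟨D, hD⟩ := hK.isBounded.exists_norm_le
  set θ : ℂ := ⟨f 1, f Complex.I⟩ with hθ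
  have hf : ∀ w : ℂ, f w = (conj θ * w).re := by
    intro w
    have : w = w.re • (1 : ℂ) + w.im • Complex.I := by
      apply Complex.ext <;> simp
    conv_lhs => rw [this, map_add, map_smul, map_smul]
    simp [hθ]
    ring
  have hsep : ∀ w ∈ suppHull μ, u - f z ≤ (conj θ * (w - z)).re := by
    intro w hw
    rw [← hf, map_sub]
    linarith [hfK w hw]
  have hd : 0 < u - f z := sub_pos.2 hfz
  have hδ : ∀ w ∈ suppHull μ, (u - f z) / (‖θ‖ + 1) ≤ ‖w - z‖ := by
    intro w hw
    rw [div_le_iff₀ (by positivity)]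
    have h1 := (hsep w hw).trans (Complex.re_le_norm _)
    rw [norm_mul, Complex.norm_conj] at h1
    nlinarith [norm_nonneg (w - z)]
  -- The denominator ‖θ‖ + 1 and the maximum keep the constants valid even when the hull is empty
  -- and θ may vanish.
  refine ⟨θ, u - f z, (u - f z) / (‖θ‖ + 1), max (D + ‖z‖) ((u - f z) / (‖θ‖ + 1)), hd,
    by positivity, le_max_right _ _, fun w hw => ⟨hsep w hw, hδ w hw, le_max_of_le_left ?_⟩⟩
  exact (norm_sub_le _ _).trans (by linarith [hD w hw])

theorem integral_monicOP_mul_complex [IsFiniteMeasure μ]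
    (hcpt : IsCompact μ.support) (hinf : μ.support.Infinite)
    {n : ℕ} {q : ℂ[X]} (hq : q.degree < n) :
    ∫ x : ℝ, (((monicOP μ n).eval x : ℝ) : ℂ) * q.eval (x : ℂ) ∂μ = 0 := by
  have hsum : ∀ x : ℝ, (((monicOP μ n).eval x : ℝ) : ℂ) * q.eval (x : ℂ) =
      ∑ k ∈ Finset.range n, q.coeff k * (((monicOP μ n).eval x * x ^ k : ℝ) : ℂ) := by
    intro x
    rcases eq_or_ne q 0 with rfl | h0
    · simp
    · rw [eval_eq_sum_range' ((natDegree_lt_iff_degree_lt h0).2 hq), Finset.mul_sum]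
      refine Finset.sum_congr rfl fun k _ => ?_
      push_cast
      ring
  simp_rw [hsum]
  rw [integral_finsetSum _ fun k _ => integrable_of_continuous hcpt (by fun_prop)]
  refine Finset.sum_eq_zero fun k hk => ?_
  have hdeg : (X ^ k : ℝ[X]).degree < n := by
    rw [degree_X_pow]
    exact Nat.cast_lt.2 (Finset.mem_range.1 hk)
  have h := integral_monicOP_mul hcpt hinf hdeg
  simp only [eval_pow, eval_X] at h
  rw [integral_const_mul, integral_complex_ofReal, h]
  simp

/-- Off the convex hull of the support, `|p_n(z)|` grows exponentially. -/
theorem exists_l2Norm_le [IsFiniteMeasure μ]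
    (hcpt : IsCompact μ.support) (hinf : μ.support.Infinite) {z : ℂ}
    (hz : z ∉ suppHull μ) : ∃ C ρ : ℝ, 0 < C ∧ 0 < ρ ∧ ρ < 1 ∧ ∀ n,
      l2Norm μ (monicOP μ n) ≤ C * ρ ^ n * ‖aeval z (monicOP μ n)‖ := by
  obtain ⟨θ, d, δ, D, hd, hδ, hδD, hsep⟩ := exists_separation hcpt hz
  have hD : 0 < D := hδ.trans_le hδD
  obtain ⟨x₀, hx₀⟩ := hinf.nonempty
  have hθ : 0 < ‖θ‖ := by
    rw [norm_pos_iff]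
    rintro rfl
    have := (hsep _ (ofReal_mem_suppHull hx₀)).1
    simp at this
    linarith
  -- The centre c is moved so far in direction θ that H lies in a disc about c strictly smaller than
  -- the one with z on its boundary: in |w - c|² the cross term contributes at most -2 t d = -2 D²,
  -- against |w - z|² ≤ D².
  set t : ℝ := D ^ 2 / d with ht
  have htpos : 0 < t := by positivity
  set c : ℂ := z + t * θ with hc
  have hzc : ‖z - c‖ = t * ‖θ‖ := by
    rw [hc, sub_add_cancel_left, norm_neg, norm_mul, Complex.norm_real,
      Real.norm_of_nonneg htpos.le]
  have hzc0 : z - c ≠ 0 := norm_pos_iff.1 (hzc ▸ by positivity)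
  have hwc : ∀ w ∈ suppHull μ, ‖w - c‖ ^ 2 ≤ (t * ‖θ‖) ^ 2 - D ^ 2 := by
    intro w hw
    obtain ⟨h1, h2, h3⟩ := hsep w hw
    have he : ‖w - c‖ ^ 2 = ‖w - z‖ ^ 2 - 2 * t * (conj θ * (w - z)).re + (t * ‖θ‖) ^ 2 := by
      rw [mul_pow]
      simp only [← Complex.normSq_eq_norm_sq, Complex.normSq_apply, hc]
      simp
      ring
    have h4 : ‖w - z‖ ^ 2 ≤ D ^ 2 := by gcongr
    have h5 : t * d = D ^ 2 := by
      rw [ht]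
      field_simp
    have h6 : t * d ≤ t * (conj θ * (w - z)).re := by gcongr
    linarith
  obtain ⟨ρ, hρ0, hρ1, hρ⟩ : ∃ ρ : ℝ, 0 < ρ ∧ ρ < 1 ∧
      ∀ w ∈ suppHull μ, ‖(w - c) / (z - c)‖ ≤ ρ := by
    have hle : 0 ≤ (t * ‖θ‖) ^ 2 - D ^ 2 :=
      (sq_nonneg _).trans (hwc _ (ofReal_mem_suppHull hx₀))
    have htθ : 0 < t * ‖θ‖ := by positivity
    have hr : √((t * ‖θ‖) ^ 2 - D ^ 2) < t * ‖θ‖ := by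
      rw [Real.sqrt_lt' htθ]
      nlinarith
    have hr1 : √((t * ‖θ‖) ^ 2 - D ^ 2) / (t * ‖θ‖) < 1 := (div_lt_one htθ).2 hr
    refine ⟨max (√((t * ‖θ‖) ^ 2 - D ^ 2) / (t * ‖θ‖)) (1 / 2), by positivity,
      max_lt hr1 (by norm_num), fun w hw => le_max_of_le_left ?_⟩
    rw [norm_div, hzc]
    gcongr
    exact Real.le_sqrt_of_sq_le (hwc w hw)
  set m : ℝ := μ.real Set.univ with hm
  have hm0 : 0 ≤ m := measureReal_nonneg
  set C : ℝ := (D ^ 2 / d) * (‖θ‖ / δ) * √m + 1 with hC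
  refine ⟨C, ρ, by positivity, hρ0, hρ1, fun n => ?_⟩
  set Pz : ℂ := aeval z (monicOP μ n) with hPz
  -- The comparison polynomial ((X - c)/(z - c))^n equals 1 at z and is at most ρ^n in modulus on H.
  -- So F vanishes at z and F / (X - z) has degree below n.
  set F : ℂ[X] := (monicOP μ n).map (algebraMap ℝ ℂ) -
    Polynomial.C Pz * (Polynomial.C (z - c)⁻¹ * (X - Polynomial.C c)) ^ n with hF
  have hFz : F.IsRoot z := by
    simp only [IsRoot, hF, eval_sub, eval_map_algebraMap, eval_mul, eval_C, eval_pow, eval_X]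
    rw [inv_mul_cancel₀ hzc0, one_pow, mul_one, hPz, sub_self]
  obtain ⟨q, hq⟩ := dvd_iff_isRoot.2 hFz
  have hFdeg : F.natDegree ≤ n := by
    refine (natDegree_sub_le _ _).trans (max_le ?_ ?_)
    · rw [natDegree_map, natDegree_monicOP]
    · refine (natDegree_C_mul_le _ _).trans (natDegree_pow_le_of_le n ?_ |>.trans_eq (mul_one n))
      exact (natDegree_C_mul_le _ _).trans (natDegree_X_sub_C_le _)
  have hqdeg : q.degree < n := by
    rcases eq_or_ne q 0 with rfl | h0
    · simp
    · rw [← natDegree_lt_iff_degree_lt h0]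
      rw [hq, natDegree_mul (X_sub_C_ne_zero z) h0, natDegree_X_sub_C] at hFdeg
      omega
  have horth := integral_monicOP_mul_complex hcpt hinf hqdeg
  set B : ℝ := ‖θ‖ / δ * ‖Pz‖ * ρ ^ n with hB
  have hB0 : 0 ≤ B := by positivity
  -- Re(θ / (x - z)) ≥ d / D² makes the main term coercive; the cross term, at most |p| B, is split
  -- by the arithmetic-geometric mean inequality and absorbs half of it. Integrating against
  -- orthogonality then bounds ‖P_n‖ by a multiple of B.
  have hpt : ∀ x ∈ μ.support, d / (2 * D ^ 2) * (monicOP μ n).eval x ^ 2 -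
      D ^ 2 / (2 * d) * B ^ 2 ≤ (θ * ((((monicOP μ n).eval x : ℝ) : ℂ) * q.eval (x : ℂ))).re := by
    intro x hx
    obtain ⟨h1, h2, h3⟩ := hsep _ (ofReal_mem_suppHull hx)
    set p : ℝ := (monicOP μ n).eval x with hp
    have hxz : 0 < ‖(x : ℂ) - z‖ := hδ.trans_le h2
    have hxz0 : (x : ℂ) - z ≠ 0 := norm_pos_iff.1 hxz
    have hqx : q.eval (x : ℂ) = ((p : ℂ) - Pz * (((x : ℂ) - c) / (z - c)) ^ n) / (x - z) := by
      have h := congrArg (eval (x : ℂ)) hq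
      simp only [hF, eval_sub, eval_map_algebraMap, eval_mul, eval_C, eval_pow, eval_X] at h
      rw [eq_div_iff hxz0, mul_comm, ← h, div_eq_inv_mul, hp, ← Complex.coe_algebraMap,
        aeval_algebraMap_apply]
      simp
    set G : ℂ := (((x : ℂ) - c) / (z - c)) ^ n with hG
    have hGn : ‖G‖ ≤ ρ ^ n := by
      rw [hG, norm_pow]
      gcongr
      exact hρ _ (ofReal_mem_suppHull hx)
    have hdec : (θ * ((p : ℂ) * q.eval (x : ℂ))).re =
        p ^ 2 * (θ / (x - z)).re - p * (θ * (Pz * G) / (x - z)).re := by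
      rw [hqx]
      have : θ * ((p : ℂ) * (((p : ℂ) - Pz * G) / (x - z))) =
          ((p ^ 2 : ℝ) : ℂ) * (θ / (x - z)) - (p : ℂ) * (θ * (Pz * G) / (x - z)) := by
        push_cast
        field_simp
      rw [this, Complex.sub_re, Complex.re_ofReal_mul, Complex.re_ofReal_mul]
    have hre : d / D ^ 2 ≤ (θ / (x - z)).re := by
      have : (θ / (x - z)).re = (conj θ * (x - z)).re / ‖(x : ℂ) - z‖ ^ 2 := by
        rw [Complex.div_re, ← Complex.normSq_eq_norm_sq]
        simp
        ring
      have h0 := hd.le.trans h1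
      rw [this]
      gcongr
    have hBn : |(θ * (Pz * G) / (x - z)).re| ≤ B := by
      refine (Complex.abs_re_le_norm _).trans ?_
      rw [norm_div, norm_mul, norm_mul, hB, div_le_iff₀ hxz]
      calc ‖θ‖ * (‖Pz‖ * ‖G‖) ≤ ‖θ‖ * (‖Pz‖ * ρ ^ n) := by gcongr
        _ = ‖θ‖ / δ * ‖Pz‖ * ρ ^ n * δ := by field_simp
        _ ≤ _ := by gcongr
    rw [hdec]
    have h4 : d / D ^ 2 * p ^ 2 ≤ p ^ 2 * (θ / (x - z)).re := by
      rw [mul_comm]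
      gcongr
    have h5 : p * (θ * (Pz * G) / (x - z)).re ≤ |p| * B := by
      refine (le_abs_self _).trans ?_
      rw [abs_mul]
      gcongr
    have h6 : |p| * B ≤ d / (2 * D ^ 2) * p ^ 2 + D ^ 2 / (2 * d) * B ^ 2 := by
      have h7 : 0 ≤ (d * |p| - D ^ 2 * B) ^ 2 / (2 * d * D ^ 2) := by positivity
      have h8 : (d * |p| - D ^ 2 * B) ^ 2 / (2 * d * D ^ 2) =
          d / (2 * D ^ 2) * |p| ^ 2 + D ^ 2 / (2 * d) * B ^ 2 - |p| * B := by
        field_simp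
        ring
      rw [sq_abs] at h8
      linarith
    have h9 : d / D ^ 2 * p ^ 2 = 2 * (d / (2 * D ^ 2) * p ^ 2) := by
      field_simp
    linarith
  have hi1 : Integrable (fun x => (monicOP μ n).eval x ^ 2) μ :=
    integrable_of_continuous hcpt (by fun_prop)
  have hi2 : Integrable (fun x : ℝ => θ * ((((monicOP μ n).eval x : ℝ) : ℂ) * q.eval (x : ℂ))) μ :=
    integrable_of_continuous hcpt (by fun_prop)
  have hint := integral_mono_ae ((hi1.const_mul (d / (2 * D ^ 2))).sub
    (integrable_const (D ^ 2 / (2 * d) * B ^ 2))) hi2.re ((ae_mem_support μ).mono hpt)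
  have hre0 : ∫ x : ℝ, RCLike.re (θ * ((((monicOP μ n).eval x : ℝ) : ℂ) * q.eval (x : ℂ))) ∂μ = 0 := by
    rw [integral_re hi2, integral_const_mul, horth]
    simp
  rw [hre0, integral_sub' (hi1.const_mul _) (integrable_const _), integral_const_mul,
    integral_const, ← l2Norm_sq, smul_eq_mul, ← hm] at hint
  have hsq : l2Norm μ (monicOP μ n) ^ 2 ≤ (D ^ 2 / d * B * √m) ^ 2 := by
    have h1 : (D ^ 2 / d * B * √m) ^ 2 =
        (m * (D ^ 2 / (2 * d) * B ^ 2)) * (2 * D ^ 2 / d) := by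
      rw [mul_pow, Real.sq_sqrt hm0]
      field_simp
    have h2 : l2Norm μ (monicOP μ n) ^ 2 =
        (d / (2 * D ^ 2) * l2Norm μ (monicOP μ n) ^ 2) * (2 * D ^ 2 / d) := by
      field_simp
    rw [h1, h2]
    exact mul_le_mul_of_nonneg_right (by linarith) (by positivity)
  refine (abs_le_of_sq_le_sq' hsq (by positivity)).2.trans ?_
  have : D ^ 2 / d * B * √m = (C - 1) * ρ ^ n * ‖Pz‖ := by
    rw [hC, hB]
    ring
  rw [this]
  gcongr
  exact sub_le_self _ zero_le_one

end LowerBound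


/-! ### The logarithmic kernel and extended integrals -/

section Kernel

theorem logKernel_of_ne {z w : ℂ} (h : z ≠ w) :
    logKernel z w = ((-Real.log ‖z - w‖ : ℝ) : EReal) := by
  have hpos : 0 < ‖z - w‖ := norm_pos_iff.2 (sub_ne_zero.2 h)
  rw [logKernel, ENNReal.log_inv, edist_dist, dist_eq_norm, ENNReal.log_ofReal_of_pos hpos]
  simp

theorem logKernel_self (z : ℂ) : logKernel z z = ⊤ := by
  simp [logKernel]

theorem measurable_logKernel : Measurable fun p : ℂ × ℂ => logKernel p.1 p.2 :=
  (measurable_edist.inv).ennreal_log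

variable {α : Type*} [MeasurableSpace α] {ν : Measure α}

theorem extIntegral_congr_ae {f g : α → EReal} (h : f =ᵐ[ν] g) :
    extIntegral ν f = extIntegral ν g := by
  have h1 : ∫⁻ x, (f x).toENNReal ∂ν = ∫⁻ x, (g x).toENNReal ∂ν :=
    lintegral_congr_ae (h.mono fun x hx => by simp only [hx])
  have h2 : ∫⁻ x, (-f x).toENNReal ∂ν = ∫⁻ x, (-g x).toENNReal ∂ν :=
    lintegral_congr_ae (h.mono fun x hx => by simp only [hx])
  rw [extIntegral, extIntegral, h1, h2]

theorem extIntegral_coe {f : α → ℝ} (hf : Integrable f ν) :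
    extIntegral ν (fun x => (f x : EReal)) = ((∫ x, f x ∂ν : ℝ) : EReal) := by
  have h1 : ∫⁻ x, ENNReal.ofReal (f x) ∂ν ≠ ⊤ := hf.lintegral_lt_top.ne
  have h2 : ∫⁻ x, ENNReal.ofReal (-f x) ∂ν ≠ ⊤ := hf.neg.lintegral_lt_top.ne
  rw [extIntegral, integral_eq_lintegral_pos_part_sub_lintegral_neg_part hf]
  simp only [← EReal.coe_neg, EReal.toENNReal_of_ne_top (EReal.coe_ne_top _), EReal.toReal_coe]
  rw [EReal.coe_sub, EReal.coe_ennreal_toReal h1, EReal.coe_ennreal_toReal h2]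

end Kernel

/-! ### Root asymptotics -/

section RootAsymptotics

variable {μ : Measure ℝ} {n : ℕ → ℕ} {l : Filter ℕ} {ν : FiniteMeasure ℂ}

theorem norm_prod_sub_eq_exp {z : ℂ} {g : ℂ → ℝ} (s : Multiset ℂ)
    (hs : ∀ w ∈ s, ‖z - w‖ = Real.exp (g w)) :
    ‖(s.map fun w => z - w).prod‖ = Real.exp (s.map g).sum := by
  induction s using Multiset.induction_on with
  | empty => simp
  | cons a s ih =>
    rw [Multiset.map_cons, Multiset.prod_cons, norm_mul, Multiset.map_cons, Multiset.sum_cons,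
      Real.exp_add, hs a (by simp), ih fun w hw => hs w (Multiset.mem_cons_of_mem hw)]

theorem tendsto_const_rpow_inv (hn : Tendsto n l atTop) {c : ℝ} (hc : 0 < c) :
    Tendsto (fun j => c ^ (1 / (n j : ℝ))) l (𝓝 1) := by
  have h : Tendsto (fun j => 1 / (n j : ℝ)) l (𝓝 0) := by
    simpa [Function.comp_def, Pi.inv_def] using
      (tendsto_natCast_atTop_atTop (R := ℝ).comp hn).inv_tendsto_atTop
  simpa using tendsto_const_nhds.rpow h (Or.inl hc.ne')

theorem norm_aeval_orthonormalP [IsFiniteMeasure μ]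
    (hcpt : IsCompact μ.support) (hinf : μ.support.Infinite)
    (n : ℕ) (z : ℂ) : ‖aeval z (orthonormalP μ n)‖ =
      ‖aeval z (monicOP μ n)‖ / l2Norm μ (monicOP μ n) := by
  have h := l2Norm_pos hcpt hinf (monicOP_monic μ n).ne_zero
  rw [orthonormalP, map_mul, aeval_C, norm_mul, Complex.coe_algebraMap, Complex.norm_real,
    Real.norm_of_nonneg (inv_nonneg.2 h.le)]
  field_simp

/-- Root asymptotics of the orthonormal polynomials along a subsequence with converging zero
counting measures. -/
theorem root_asymptotics [IsFiniteMeasure μ]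
    [l.NeBot] (hcpt : IsCompact μ.support) (hinf : μ.support.Infinite)
    (hn : Tendsto n l atTop) (hν : Tendsto (fun j => zeroCounting μ (n j)) l (𝓝 ν))
    {A : ℝ} (hA : Tendsto (fun j => jacobiMean μ (n j)) l (𝓝 A)) (hApos : 0 < A)
    {z : ℂ} (hz : z ∉ suppHull μ) :
    ∃ φ : ℝ, potential (ν : Measure ℂ) z = (φ : EReal) ∧
      Tendsto (fun j => ‖aeval z (orthonormalP μ (n j))‖ ^ (1 / (n j : ℝ))) l
        (𝓝 (A⁻¹ * Real.exp (-φ))) ∧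
      A < Real.exp (-φ) := by
  obtain ⟨_, _, δ, D, _, hδ, hδD, hsep⟩ := exists_separation hcpt hz
  -- Clamping |w - z| to [δ, D] makes the logarithm bounded and continuous on ℂ without changing it
  -- on H, which contains all zeros and almost all of ν.
  let g : ℂ → ℝ := fun w => Real.log (max δ (min D ‖w - z‖))
  have hpos : ∀ w : ℂ, 0 < max δ (min D ‖w - z‖) := fun w => lt_max_of_lt_left hδ
  have hgc : Continuous g := Continuous.log (by fun_prop) fun w => (hpos w).ne'
  have hgb : ∀ w, ‖g w‖ ≤ max |Real.log δ| |Real.log D| := fun w => by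
    refine abs_le_max_abs_abs (Real.log_le_log hδ (le_max_left _ _))
      (Real.log_le_log (hpos w) (max_le hδD (min_le_left _ _)))
  let f : BoundedContinuousFunction ℂ ℝ :=
    BoundedContinuousFunction.ofNormedAddCommGroup g hgc _ hgb
  have hgH : ∀ w ∈ suppHull μ, g w = Real.log ‖z - w‖ := fun w hw => by
    obtain ⟨-, h1, h2⟩ := hsep w hw
    simp only [g]
    rw [min_eq_right h2, max_eq_right h1, norm_sub_rev]
  have hposH : ∀ w ∈ suppHull μ, 0 < ‖z - w‖ := fun w hw => by
    rw [norm_sub_rev]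
    exact hδ.trans_le (hsep w hw).2.1
  have haeH : ∀ᵐ w ∂(ν : Measure ℂ), w ∈ suppHull μ :=
    measure_mono_null (Set.compl_subset_compl.2 (essSupport_subset_suppHull μ))
      (measure_compl_essSupport hcpt hinf hn hν)
  have hP : ∀ m, ‖aeval z (monicOP μ m)‖ = Real.exp ((zeros μ m).map g).sum := fun m => by
    rw [prod_zeros]
    refine norm_prod_sub_eq_exp _ fun w hw => ?_
    have hw' := mem_suppHull_of_mem_zeros hcpt hinf hw
    rw [hgH w hw', Real.exp_log (hposH w hw')]
  have hl : ∀ m, 0 < l2Norm μ (monicOP μ m) := fun m =>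
    l2Norm_pos hcpt hinf (monicOP_monic μ m).ne_zero
  have hlim : Tendsto (fun j => ‖aeval z (orthonormalP μ (n j))‖ ^ (1 / (n j : ℝ))) l
      (𝓝 (A⁻¹ * Real.exp (- -∫ w, g w ∂ν))) := by
    have h1 : Tendsto (fun j => Real.exp ((n j : ℝ)⁻¹ * ((zeros μ (n j)).map f).sum)) l
        (𝓝 (Real.exp (∫ w, g w ∂ν))) := (tendsto_sum_zeros hν f).rexp
    have h2 := (hA.mul (tendsto_const_rpow_inv hn (hl 0))).inv₀ (by simpa using hApos.ne')
    have h3 := h2.mul h1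
    rw [mul_one] at h3
    rw [neg_neg]
    refine h3.congr fun j => ?_
    rw [norm_aeval_orthonormalP hcpt hinf, Real.div_rpow (norm_nonneg _) (hl _).le, hP,
      ← Real.exp_mul, jacobiMean, prod_jacobiA hcpt hinf, ← Real.mul_rpow
      (div_nonneg (hl _).le (hl _).le) (hl 0).le, div_mul_cancel₀ _ (hl 0).ne', one_div,
      mul_comm ((n j : ℝ)⁻¹), div_eq_inv_mul]
    rfl
  refine ⟨-∫ w, g w ∂ν, ?_, hlim, ?_⟩
  · rw [potential, ← integral_neg, ← extIntegral_coe (f := fun w => -g w) (f.integrable _).neg]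
    refine extIntegral_congr_ae (haeH.mono fun w hw => ?_)
    have hne : z ≠ w := fun h => by simpa [h] using hposH w hw
    rw [logKernel_of_ne hne, ← hgH w hw]
  · obtain ⟨C, ρ, hC, hρ0, hρ1, hCρ⟩ := exists_l2Norm_le hcpt hinf hz
    -- Taking n-th roots in |p_n(z)| ≥ C⁻¹ ρ⁻ⁿ keeps the limit at least ρ⁻¹, hence strictly above 1.
    have h1 : Tendsto (fun j => (C⁻¹) ^ (1 / (n j : ℝ)) * ρ⁻¹) l (𝓝 (1 * ρ⁻¹)) :=
      (tendsto_const_rpow_inv hn (inv_pos.2 hC)).mul_const _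
    have h2 : 1 * ρ⁻¹ ≤ A⁻¹ * Real.exp (- -∫ w, g w ∂ν) := by
      refine le_of_tendsto_of_tendsto h1 hlim ?_
      filter_upwards [hn.eventually_gt_atTop 0] with j hj
      have hj' : (n j : ℝ) ≠ 0 := by positivity
      have h3 : C⁻¹ * (ρ⁻¹) ^ (n j) ≤ ‖aeval z (orthonormalP μ (n j))‖ := by
        rw [norm_aeval_orthonormalP hcpt hinf, le_div_iff₀ (hl _)]
        calc C⁻¹ * ρ⁻¹ ^ n j * l2Norm μ (monicOP μ (n j))
            ≤ C⁻¹ * ρ⁻¹ ^ n j * (C * ρ ^ n j * ‖aeval z (monicOP μ (n j))‖) := by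
              gcongr
              exact hCρ _
          _ = (ρ⁻¹ * ρ) ^ n j * (C⁻¹ * C) * ‖aeval z (monicOP μ (n j))‖ := by ring
          _ = _ := by
            rw [inv_mul_cancel₀ hρ0.ne', inv_mul_cancel₀ hC.ne', one_pow, one_mul, one_mul]
      have h4 : C⁻¹ ^ (1 / (n j : ℝ)) * ρ⁻¹ = (C⁻¹ * (ρ⁻¹) ^ (n j)) ^ (1 / (n j : ℝ)) := by
        rw [Real.mul_rpow (by positivity) (by positivity), ← Real.rpow_natCast,
          ← Real.rpow_mul (by positivity), mul_one_div_cancel hj', Real.rpow_one]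
      rw [h4]
      gcongr
    have h5 : 1 < ρ⁻¹ := (one_lt_inv₀ hρ0).2 hρ1
    rw [one_mul] at h2
    have h6 := h5.trans_le h2
    rwa [inv_mul_eq_div, one_lt_div hApos] at h6

end RootAsymptotics


/-! ### Extended integrals of functions bounded below -/

section ExtIntegral

variable {α : Type*} [MeasurableSpace α]

/-- The extended integral of a function bounded below in terms of a Lebesgue integral. -/
theorem extIntegral_eq_lintegral_sub (π : Measure α) [IsProbabilityMeasure π] {f : α → EReal}
    (hf : Measurable f) {c : ℝ} (hc : 0 ≤ c) (hfc : ∀ᵐ x ∂π, ((-c : ℝ) : EReal) ≤ f x) :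
    extIntegral π f = ((∫⁻ x, (f x + (c : EReal)).toENNReal ∂π : ℝ≥0∞) : EReal) - (c : EReal) := by
  -- This is f + c = f⁺ - f⁻ + c rearranged without subtraction, so that it also holds where f is
  -- infinite.
  have hpt : ∀ᵐ x ∂π, (f x + (c : EReal)).toENNReal + (-f x).toENNReal =
      (f x).toENNReal + ENNReal.ofReal c := by
    filter_upwards [hfc] with x hx
    induction h : f x with
    | bot => simp [h] at hx
    | top => simp
    | coe r =>
      rw [h] at hx
      have hr : -c ≤ r := by exact_mod_cast hx
      rw [← EReal.coe_add, ← EReal.coe_neg]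
      simp only [EReal.toENNReal_of_ne_top (EReal.coe_ne_top _), EReal.toReal_coe]
      rcases le_total 0 r with h0 | h0
      · rw [ENNReal.ofReal_of_nonpos (by linarith : -r ≤ 0), add_zero, ENNReal.ofReal_add h0 hc]
      · rw [ENNReal.ofReal_of_nonpos h0, zero_add, ← ENNReal.ofReal_add (by linarith) (by linarith)]
        congr 1
        ring
  have hN : ∫⁻ x, (-f x).toENNReal ∂π ≤ ENNReal.ofReal c := by
    calc ∫⁻ x, (-f x).toENNReal ∂π ≤ ∫⁻ _, ENNReal.ofReal c ∂π := by
          refine lintegral_mono_ae ?_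
          filter_upwards [hfc] with x hx
          have : -f x ≤ (c : EReal) := by
            rw [EReal.neg_le]
            simpa using hx
          simpa using EReal.toENNReal_le_toENNReal this
      _ = ENNReal.ofReal c := by simp
  have hsum := lintegral_congr_ae hpt
  rw [lintegral_add_left (by fun_prop), lintegral_add_right _ measurable_const, lintegral_const,
    measure_univ, mul_one] at hsum
  rw [extIntegral]
  set I := ∫⁻ x, (f x + (c : EReal)).toENNReal ∂π
  set P := ∫⁻ x, (f x).toENNReal ∂π
  clear_value I P
  lift ∫⁻ x, (-f x).toENNReal ∂π to ℝ≥0 using (hN.trans_lt ENNReal.ofReal_lt_top).ne with N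
  rcases eq_or_ne P ⊤ with hP | hP
  · have hI : I = ⊤ := by
      rw [hP, top_add] at hsum
      by_contra hne
      exact ENNReal.add_ne_top.2 ⟨hne, ENNReal.coe_ne_top⟩ hsum
    rw [hP, hI]
    rfl
  · have hI : I ≠ ⊤ := by
      intro h
      rw [h, top_add] at hsum
      exact ENNReal.add_ne_top.2 ⟨hP, ENNReal.ofReal_ne_top⟩ hsum.symm
    lift P to ℝ≥0 using hP
    lift I to ℝ≥0 using hI
    have h := congrArg ENNReal.toReal hsum
    rw [ENNReal.toReal_add ENNReal.coe_ne_top ENNReal.coe_ne_top,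
      ENNReal.toReal_add ENNReal.coe_ne_top ENNReal.ofReal_ne_top, ENNReal.toReal_ofReal hc] at h
    simp only [ENNReal.coe_toReal] at h
    have e : ∀ x : ℝ≥0, ((x : ℝ≥0∞) : EReal) = ((x : ℝ) : EReal) := fun _ => rfl
    rw [e, e, e, ← EReal.coe_sub, ← EReal.coe_sub]
    congr 1
    linarith

end ExtIntegral

/-! ### The kernel made nonnegative by a shift -/

section ShiftedKernel

/-- The logarithmic kernel `log (R / |z - w|)`, truncated below at zero. -/
noncomputable def shiftedKernel (R : ℝ) (z w : ℂ) : ℝ≥0∞ :=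
  (logKernel z w + (Real.log R : EReal)).toENNReal

theorem shiftedKernel_of_ne (R : ℝ) {z w : ℂ} (h : z ≠ w) :
    shiftedKernel R z w = ENNReal.ofReal (Real.log R - Real.log ‖z - w‖) := by
  rw [shiftedKernel, logKernel_of_ne h, ← EReal.coe_add,
    EReal.toENNReal_of_ne_top (EReal.coe_ne_top _), EReal.toReal_coe]
  congr 1
  ring

theorem shiftedKernel_self (R : ℝ) (z : ℂ) : shiftedKernel R z z = ⊤ := by
  rw [shiftedKernel, logKernel_self]
  simp

theorem measurable_shiftedKernel (R : ℝ) :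
    Measurable fun p : ℂ × ℂ => shiftedKernel R p.1 p.2 :=
  (measurable_logKernel.add measurable_const).ereal_toENNReal

theorem continuous_shiftedKernel {R : ℝ} (w : ℂ) :
    Continuous fun z => shiftedKernel R z w := by
  have h1 : Continuous fun z => logKernel z w :=
    ENNReal.continuous_log.comp ((continuous_id.edist continuous_const).inv)
  have h2 : Continuous fun z => logKernel z w + (Real.log R : EReal) := by
    refine continuous_iff_continuousAt.2 fun z => ?_
    exact (EReal.continuousAt_add (Or.inr (EReal.coe_ne_bot _))
      (Or.inr (EReal.coe_ne_top _))).comp (f := fun z => (logKernel z w, (Real.log R : EReal)))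
      (h1.continuousAt.prodMk continuousAt_const)
  exact EReal.continuous_toENNReal.comp h2

theorem neg_log_le_logKernel {R : ℝ} {z w : ℂ} (h : ‖z - w‖ ≤ R) :
    ((-Real.log R : ℝ) : EReal) ≤ logKernel z w := by
  rcases eq_or_ne z w with rfl | hne
  · rw [logKernel_self]
    exact le_top
  · rw [logKernel_of_ne hne, EReal.coe_le_coe_iff]
    have := Real.log_le_log (norm_pos_iff.2 (sub_ne_zero.2 hne)) h
    linarith

theorem potential_eq_lintegral_sub {ν : Measure ℂ} [IsProbabilityMeasure ν] {R : ℝ} (hR : 1 ≤ R)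
    {z : ℂ} (h : ∀ᵐ w ∂ν, ‖z - w‖ ≤ R) :
    potential ν z = ((∫⁻ w, shiftedKernel R z w ∂ν : ℝ≥0∞) : EReal) - (Real.log R : EReal) :=
  extIntegral_eq_lintegral_sub ν (measurable_logKernel.comp measurable_prodMk_left)
    (Real.log_nonneg hR) (h.mono fun _ hw => neg_log_le_logKernel hw)

theorem energy_eq_lintegral_sub {ν : Measure ℂ} [IsProbabilityMeasure ν] {R : ℝ} (hR : 1 ≤ R)
    {K : Set ℂ} (hν : ν Kᶜ = 0) (hK : ∀ z ∈ K, ∀ w ∈ K, ‖z - w‖ ≤ R) :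
    energy ν = ((∫⁻ z, ∫⁻ w, shiftedKernel R z w ∂ν ∂ν : ℝ≥0∞) : EReal) - (Real.log R : EReal) := by
  have hK' : ∀ᵐ z ∂ν, z ∈ K := hν
  have h1 : ∀ᵐ p ∂ν.prod ν, p.1 ∈ K := Measure.quasiMeasurePreserving_fst.ae hK'
  have h2 : ∀ᵐ p ∂ν.prod ν, p.2 ∈ K := Measure.quasiMeasurePreserving_snd.ae hK'
  rw [energy, extIntegral_eq_lintegral_sub (ν.prod ν) measurable_logKernel (Real.log_nonneg hR)
    (by filter_upwards [h1, h2] with p hp1 hp2 using neg_log_le_logKernel (hK _ hp1 _ hp2))]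
  congr 2
  exact lintegral_prod _ (measurable_shiftedKernel R).aemeasurable

end ShiftedKernel

/-! ### The kernel as a superposition of interval indicators -/

section Representation

/-- The weight `s⁻² ds` on `(0, R)` together with a point mass `R⁻¹` at `R`. -/
noncomputable def scaleMeasure (R : ℝ) : Measure ℝ :=
  (volume.restrict (Set.Ioo 0 R)).withDensity (fun s => ENNReal.ofReal (s⁻¹ ^ 2)) +
    ENNReal.ofReal R⁻¹ • Measure.dirac R

instance (R : ℝ) : SFinite (scaleMeasure R) := by
  unfold scaleMeasure
  infer_instance

/-- The indicator of `u < x < u + s`, where `ω = (u, s)`. -/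
noncomputable def window (x : ℝ) (ω : ℝ × ℝ) : ℝ≥0∞ :=
  (Set.Ioo ω.1 (ω.1 + ω.2)).indicator 1 x

theorem measurable_window : Measurable fun p : ℝ × (ℝ × ℝ) => window p.1 p.2 := by
  have h1 : MeasurableSet {p : ℝ × (ℝ × ℝ) | p.2.1 < p.1} :=
    measurableSet_lt (by fun_prop) (by fun_prop)
  have h2 : MeasurableSet {p : ℝ × (ℝ × ℝ) | p.1 < p.2.1 + p.2.2} :=
    measurableSet_lt (by fun_prop) (by fun_prop)
  exact (measurable_const (a := (1 : ℝ≥0∞))).indicator (h1.inter h2)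

theorem lintegral_window_mul_window (x y s : ℝ) :
    ∫⁻ u, window x (u, s) * window y (u, s) = ENNReal.ofReal (s - |x - y|) := by
  have h : ∀ u, window x (u, s) * window y (u, s) =
      (Set.Ioo (max x y - s) (min x y)).indicator 1 u := by
    intro u
    have : u ∈ Set.Ioo (max x y - s) (min x y) ↔
        x ∈ Set.Ioo u (u + s) ∧ y ∈ Set.Ioo u (u + s) := by
      rw [Set.mem_Ioo, Set.mem_Ioo, Set.mem_Ioo, sub_lt_iff_lt_add, max_lt_iff, lt_min_iff]
      tauto
    simp only [window, Set.indicator_apply, this, Pi.one_apply]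
    split_ifs <;> simp_all
  simp_rw [h]
  rw [lintegral_indicator_one measurableSet_Ioo, Real.volume_Ioo]
  congr 1
  rw [← max_sub_min_eq_abs']
  ring

/-- The integrand vanishes for s ≤ r, and beyond r it has antiderivative log s + r / s. The atom of
`scaleMeasure` at R supplies the missing 1 - r / R, leaving exactly log(R / r). -/
theorem lintegral_scale {r R : ℝ} (hr : 0 < r) (hrR : r ≤ R) :
    ∫⁻ s in Set.Ioo 0 R, ENNReal.ofReal (s⁻¹ ^ 2) * ENNReal.ofReal (s - r) =
      ENNReal.ofReal (Real.log R - Real.log r - 1 + r / R) := by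
  have hR : 0 < R := hr.trans_le hrR
  have hderiv : ∀ s ∈ Set.uIcc r R, HasDerivAt (fun s => Real.log s + r * s⁻¹)
      (s⁻¹ + r * (-(s ^ 2)⁻¹)) s := by
    intro s hs
    rw [Set.uIcc_of_le hrR] at hs
    have hs0 : s ≠ 0 := (hr.trans_le hs.1).ne'
    exact (Real.hasDerivAt_log hs0).add ((hasDerivAt_inv hs0).const_mul r)
  have hcont : ContinuousOn (fun s : ℝ => s⁻¹ + r * (-(s ^ 2)⁻¹)) (Set.uIcc r R) := by
    rw [Set.uIcc_of_le hrR]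
    have h0 : ∀ s ∈ Set.Icc r R, s ≠ 0 := fun s hs => (hr.trans_le hs.1).ne'
    exact (continuousOn_id.inv₀ h0).add (continuousOn_const.mul
      ((continuousOn_id.pow 2).inv₀ fun s hs => pow_ne_zero 2 (h0 s hs)).neg)
  have hFTC := intervalIntegral.integral_eq_sub_of_hasDerivAt hderiv hcont.intervalIntegrable
  have hle : ∀ s ∈ Set.Ioo r R, s⁻¹ + r * (-(s ^ 2)⁻¹) = s⁻¹ ^ 2 * (s - r) := by
    intro s hs
    have hs0 : s ≠ 0 := (hr.trans hs.1).ne'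
    field_simp
    ring
  calc ∫⁻ s in Set.Ioo 0 R, ENNReal.ofReal (s⁻¹ ^ 2) * ENNReal.ofReal (s - r)
      = ∫⁻ s in Set.Ioo r R, ENNReal.ofReal (s⁻¹ ^ 2) * ENNReal.ofReal (s - r) := by
        rw [← lintegral_indicator measurableSet_Ioo, ← lintegral_indicator measurableSet_Ioo]
        refine lintegral_congr fun s => ?_
        simp only [Set.indicator_apply, Set.mem_Ioo]
        by_cases hs : r < s
        · simp [hs, hr.trans hs]
        · rw [ENNReal.ofReal_of_nonpos (sub_nonpos.2 (not_lt.1 hs))]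
          simp
    _ = ∫⁻ s in Set.Ioo r R, ENNReal.ofReal (s⁻¹ + r * (-(s ^ 2)⁻¹)) := by
        refine setLIntegral_congr_fun measurableSet_Ioo fun s hs => ?_
        rw [← ENNReal.ofReal_mul (by positivity), hle s hs]
    _ = ENNReal.ofReal (∫ s in Set.Ioo r R, (s⁻¹ + r * (-(s ^ 2)⁻¹))) := by
        rw [ofReal_integral_eq_lintegral_ofReal]
        · rw [Set.uIcc_of_le hrR] at hcont
          exact (hcont.integrableOn_compact isCompact_Icc).mono_set Set.Ioo_subset_Icc_self
        · refine (ae_restrict_iff' measurableSet_Ioo).2 (ae_of_all _ fun s hs => ?_)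
          change 0 ≤ s⁻¹ + r * (-(s ^ 2)⁻¹)
          rw [hle s hs]
          exact mul_nonneg (by positivity) (sub_nonneg.2 hs.1.le)
    _ = _ := by
        rw [← integral_Ioc_eq_integral_Ioo, ← intervalIntegral.integral_of_le hrR, hFTC]
        congr 1
        field_simp
        ring

theorem lintegral_scale_zero {R : ℝ} (hR : 0 < R) :
    ∫⁻ s in Set.Ioo 0 R, ENNReal.ofReal (s⁻¹ ^ 2) * ENNReal.ofReal s = ⊤ := by
  refine ENNReal.eq_top_of_forall_nnreal_le fun M => ?_
  -- With this r, log(R / r) - 1 = M, and s - r ≤ s bounds the divergent integral below by M.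
  set r : ℝ := R * Real.exp (-(M + 1)) with hr
  have hr0 : 0 < r := by positivity
  have hrR : r ≤ R := by
    refine mul_le_of_le_one_right hR.le (Real.exp_le_one_iff.2 ?_)
    simp only [neg_add_rev]
    have h : (0 : ℝ) ≤ M := M.2
    linarith
  have h1 : (M : ℝ≥0∞) ≤ ENNReal.ofReal (Real.log R - Real.log r - 1 + r / R) := by
    rw [← ENNReal.ofReal_coe_nnreal]
    refine ENNReal.ofReal_le_ofReal ?_
    rw [hr, Real.log_mul hR.ne' (Real.exp_ne_zero _), Real.log_exp]
    have : 0 < R * Real.exp (-(M + 1)) / R := by positivity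
    linarith
  refine h1.trans ?_
  rw [← lintegral_scale hr0 hrR]
  refine lintegral_mono fun s => ?_
  gcongr
  linarith

/-- The logarithmic kernel on the line as a superposition of products of indicators. -/
theorem shiftedKernel_eq_lintegral {R : ℝ} (hR : 0 < R) {x y : ℝ} (hxy : |x - y| ≤ R) :
    shiftedKernel R x y =
      ∫⁻ ω, window x ω * window y ω ∂((volume : Measure ℝ).prod (scaleMeasure R)) := by
  have hm : ∀ x : ℝ, Measurable (window x) := fun x =>
    measurable_window.comp measurable_prodMk_left
  have h := lintegral_prod_symm (μ := (volume : Measure ℝ)) (ν := scaleMeasure R) _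
    ((hm x).mul (hm y)).aemeasurable
  simp only [Pi.mul_apply] at h
  rw [h]
  simp only [lintegral_window_mul_window]
  rw [scaleMeasure, lintegral_add_measure, lintegral_smul_measure, lintegral_dirac,
    lintegral_withDensity_eq_lintegral_mul _ (by fun_prop) (by fun_prop)]
  simp only [Pi.mul_apply, smul_eq_mul]
  rcases eq_or_ne x y with rfl | hne
  · rw [shiftedKernel_self]
    simp only [sub_self, abs_zero, sub_zero]
    rw [lintegral_scale_zero hR, top_add]
  · have hr : 0 < |x - y| := abs_pos.2 (sub_ne_zero.2 hne)
    rw [lintegral_scale hr hxy, shiftedKernel_of_ne R (by exact_mod_cast hne),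
      ← ENNReal.ofReal_mul (by positivity), ← ENNReal.ofReal_add]
    · rw [← Complex.ofReal_sub, Complex.norm_real, Real.norm_eq_abs]
      congr 1
      field_simp
      ring
    · have h1 := Real.one_sub_inv_le_log_of_pos (div_pos hR hr)
      rw [Real.log_div hR.ne' hr.ne', inv_div] at h1
      linarith
    · exact mul_nonneg (by positivity) (sub_nonneg.2 hxy)

/-- By Tonelli the double integral of a product of windows becomes a square. This exhibits the
shifted energy as a squared L² norm. -/
theorem lintegral_shiftedKernel_eq {η : Measure ℝ} [IsProbabilityMeasure η] {R L : ℝ}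
    (hR : 0 < R) (hLR : 2 * L ≤ R) (hη : ∀ᵐ x ∂η, x ∈ Set.Icc (-L) L) :
    ∫⁻ x : ℝ, ∫⁻ y : ℝ, shiftedKernel R (x : ℂ) (y : ℂ) ∂η ∂η =
      ∫⁻ ω, η (Set.Ioo ω.1 (ω.1 + ω.2)) ^ 2 ∂((volume : Measure ℝ).prod (scaleMeasure R)) := by
  have hF : ∀ ω : ℝ × ℝ, ∫⁻ x, window x ω ∂η = η (Set.Ioo ω.1 (ω.1 + ω.2)) := fun ω =>
    lintegral_indicator_one measurableSet_Ioo
  have hm : ∀ x : ℝ, Measurable (window x) := fun x =>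
    measurable_window.comp measurable_prodMk_left
  have hm' : ∀ ω, Measurable fun x => window x ω := fun ω =>
    measurable_window.comp measurable_prodMk_right
  have hFm : Measurable fun ω : ℝ × ℝ => ∫⁻ x, window x ω ∂η :=
    Measurable.lintegral_prod_left' measurable_window
  have h1 : ∀ᵐ x : ℝ ∂η, ∫⁻ y : ℝ, shiftedKernel R (x : ℂ) (y : ℂ) ∂η =
      ∫⁻ ω, window x ω * (∫⁻ y, window y ω ∂η) ∂((volume : Measure ℝ).prod (scaleMeasure R)) := by
    filter_upwards [hη] with x hx
    have : ∀ᵐ y : ℝ ∂η, shiftedKernel R (x : ℂ) (y : ℂ) =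
        ∫⁻ ω, window x ω * window y ω ∂((volume : Measure ℝ).prod (scaleMeasure R)) := by
      filter_upwards [hη] with y hy
      refine shiftedKernel_eq_lintegral hR ?_
      rw [abs_le]
      constructor <;> linarith [hx.1, hx.2, hy.1, hy.2]
    rw [lintegral_congr_ae this, lintegral_lintegral_swap]
    · exact lintegral_congr fun ω => lintegral_const_mul _ (hm' ω)
    · exact (((hm x).comp measurable_snd).mul measurable_window).aemeasurable
  rw [lintegral_congr_ae h1, lintegral_lintegral_swap]
  · refine lintegral_congr fun ω => ?_
    rw [lintegral_mul_const _ (hm' ω), hF, sq]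
  · exact (measurable_window.mul (hFm.comp measurable_snd)).aemeasurable

end Representation


/-! ### Strict convexity and uniqueness of the equilibrium measure -/

section Uniqueness

/-- Distribution functions are right-continuous, and every interval to the right of u contains
points where they agree. -/
theorem measure_eq_of_ae_Iic_eq {η₁ η₂ : Measure ℝ} [IsProbabilityMeasure η₁]
    [IsProbabilityMeasure η₂] (h : ∀ᵐ u : ℝ, η₁ (Set.Iic u) = η₂ (Set.Iic u)) : η₁ = η₂ := by
  refine Measure.eq_of_cdf _ _ (StieltjesFunction.ext fun u => ?_)
  have h1 : Tendsto (ProbabilityTheory.cdf η₁) (𝓝[>] u) (𝓝 (ProbabilityTheory.cdf η₁ u)) :=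
    ((ProbabilityTheory.cdf η₁).right_continuous u).mono Set.Ioi_subset_Ici_self
  have h2 : Tendsto (ProbabilityTheory.cdf η₂) (𝓝[>] u) (𝓝 (ProbabilityTheory.cdf η₂ u)) :=
    ((ProbabilityTheory.cdf η₂).right_continuous u).mono Set.Ioi_subset_Ici_self
  refine tendsto_nhds_unique_of_frequently_eq h1 h2 (frequently_iff.2 fun {U} hU => ?_)
  obtain ⟨v, huv, hv⟩ := mem_nhdsGT_iff_exists_Ioo_subset.1 hU
  by_contra! hcon
  have : volume (Set.Ioo u v) = 0 := by
    refine measure_mono_null (fun x hx => ?_) (ae_iff.1 h)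
    intro hxe
    refine hcon x (hv hx) ?_
    rw [ProbabilityTheory.cdf_eq_real, ProbabilityTheory.cdf_eq_real, measureReal_def,
      measureReal_def]
    exact congrArg _ hxe
  rw [Real.volume_Ioo, ENNReal.ofReal_eq_zero] at this
  exact absurd (Set.mem_Ioi.1 huv) (not_lt.2 (by linarith))

/-- Parallelogram identity: two vectors of equal finite norm whose midpoint is no shorter must
coincide. -/
theorem lintegral_sq_sub_add {Ω : Type*} [MeasurableSpace Ω] {m : Measure Ω} {F₁ F₂ : Ω → ℝ≥0∞}
    (hF₁ : Measurable F₁) (hF₂ : Measurable F₂) (h₁ : ∀ ω, F₁ ω ≠ ⊤) (h₂ : ∀ ω, F₂ ω ≠ ⊤)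
    {V : ℝ≥0∞} (hV : V ≠ ⊤) (hV₁ : ∫⁻ ω, F₁ ω ^ 2 ∂m = V) (hV₂ : ∫⁻ ω, F₂ ω ^ 2 ∂m = V)
    (hmid : V ≤ ∫⁻ ω, (2⁻¹ * F₁ ω + 2⁻¹ * F₂ ω) ^ 2 ∂m) : F₁ =ᵐ[m] F₂ := by
  let d : Ω → ℝ≥0∞ := fun ω => ENNReal.ofReal ((((F₁ ω).toReal - (F₂ ω).toReal) / 2) ^ 2)
  have hd : Measurable d := by fun_prop
  have hpt : ∀ ω, (2⁻¹ * F₁ ω + 2⁻¹ * F₂ ω) ^ 2 + d ω = 2⁻¹ * F₁ ω ^ 2 + 2⁻¹ * F₂ ω ^ 2 := by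
    intro ω
    have e₁ := (ENNReal.ofReal_toReal (h₁ ω)).symm
    have e₂ := (ENNReal.ofReal_toReal (h₂ ω)).symm
    have e : (2⁻¹ : ℝ≥0∞) = ENNReal.ofReal 2⁻¹ := by
      rw [ENNReal.ofReal_inv_of_pos two_pos, ENNReal.ofReal_ofNat]
    have p₁ : 0 ≤ (F₁ ω).toReal := ENNReal.toReal_nonneg
    have p₂ : 0 ≤ (F₂ ω).toReal := ENNReal.toReal_nonneg
    simp only [d]
    rw [e₁, e₂, e, ENNReal.toReal_ofReal p₁, ENNReal.toReal_ofReal p₂,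
      ← ENNReal.ofReal_mul (by positivity), ← ENNReal.ofReal_mul (by positivity),
      ← ENNReal.ofReal_add (by positivity) (by positivity), ← ENNReal.ofReal_pow (by positivity),
      ← ENNReal.ofReal_add (by positivity) (by positivity), ← ENNReal.ofReal_pow p₁,
      ← ENNReal.ofReal_pow p₂, ← ENNReal.ofReal_mul (by positivity),
      ← ENNReal.ofReal_mul (by positivity), ← ENNReal.ofReal_add (by positivity) (by positivity)]
    congr 1
    ring
  have hsum := lintegral_congr (μ := m) hpt
  rw [lintegral_add_right _ hd, lintegral_add_left (by fun_prop),
    lintegral_const_mul _ (by fun_prop), lintegral_const_mul _ (by fun_prop), hV₁, hV₂, ← add_mul,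
    ENNReal.inv_two_add_inv_two, one_mul] at hsum
  have hd0 : ∫⁻ ω, d ω ∂m = 0 := by
    have hle : V + ∫⁻ ω, d ω ∂m ≤ V + 0 := by
      rw [add_zero]
      calc _ ≤ _ := by gcongr
        _ = V := hsum
    exact nonpos_iff_eq_zero.1 ((ENNReal.add_le_add_iff_left hV).1 hle)
  filter_upwards [(lintegral_eq_zero_iff hd).1 hd0] with ω hω
  have h0 : (((F₁ ω).toReal - (F₂ ω).toReal) / 2) ^ 2 ≤ 0 := ENNReal.ofReal_eq_zero.1 hω
  have h3 : ((F₁ ω).toReal - (F₂ ω).toReal) / 2 = 0 :=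
    pow_eq_zero_iff two_ne_zero |>.1 (le_antisymm h0 (sq_nonneg _))
  rw [← ENNReal.toReal_eq_toReal_iff' (h₁ ω) (h₂ ω)]
  linarith

theorem measurable_measure_Ioo (η : Measure ℝ) [SFinite η] :
    Measurable fun ω : ℝ × ℝ => η (Set.Ioo ω.1 (ω.1 + ω.2)) := by
  have h : ∀ ω : ℝ × ℝ, ∫⁻ x, window x ω ∂η = η (Set.Ioo ω.1 (ω.1 + ω.2)) := fun ω =>
    lintegral_indicator_one measurableSet_Ioo
  simpa only [h] using Measurable.lintegral_prod_left' (μ := η) measurable_window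

/-- Strict convexity of the logarithmic energy on a bounded interval. -/
theorem measure_eq_of_le_midpoint {η₁ η₂ : Measure ℝ} [IsProbabilityMeasure η₁]
    [IsProbabilityMeasure η₂] {R L : ℝ} (hR : 0 < R) (hLR : 2 * L < R)
    (h₁ : ∀ᵐ x ∂η₁, x ∈ Set.Icc (-L) L) (h₂ : ∀ᵐ x ∂η₂, x ∈ Set.Icc (-L) L)
    {V : ℝ≥0∞} (hV : V ≠ ⊤)
    (hV₁ : ∫⁻ ω, η₁ (Set.Ioo ω.1 (ω.1 + ω.2)) ^ 2
      ∂((volume : Measure ℝ).prod (scaleMeasure R)) = V)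
    (hV₂ : ∫⁻ ω, η₂ (Set.Ioo ω.1 (ω.1 + ω.2)) ^ 2
      ∂((volume : Measure ℝ).prod (scaleMeasure R)) = V)
    (hmid : V ≤ ∫⁻ ω, (((2⁻¹ : ℝ≥0∞) • η₁ + (2⁻¹ : ℝ≥0∞) • η₂) (Set.Ioo ω.1 (ω.1 + ω.2))) ^ 2
      ∂((volume : Measure ℝ).prod (scaleMeasure R))) : η₁ = η₂ := by
  have hae := lintegral_sq_sub_add (measurable_measure_Ioo η₁) (measurable_measure_Ioo η₂)
    (fun _ => measure_ne_top _ _) (fun _ => measure_ne_top _ _) hV hV₁ hV₂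
    (by simpa only [Measure.add_apply, Measure.smul_apply, smul_eq_mul] using hmid)
  have hae' := Measure.ae_ae_of_ae_prod hae
  refine measure_eq_of_ae_Iic_eq ?_
  -- Since R > 2L, for u > L - R the window (u, u + R) contains everything in [-L, L] to the right
  -- of u; for smaller u nothing lies to its left.
  have hIic : ∀ η : Measure ℝ, IsProbabilityMeasure η → (∀ᵐ x ∂η, x ∈ Set.Icc (-L) L) →
      ∀ u, η (Set.Iic u) = if L - R < u then 1 - η (Set.Ioo u (u + R)) else 0 := by
    intro η _ hη u
    split_ifs with hu
    · rw [← prob_compl_eq_one_sub measurableSet_Ioo]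
      refine measure_congr ?_
      filter_upwards [hη] with x hx
      refine propext ⟨fun hxu h => absurd hxu (not_le.2 h.1), fun hxu => ?_⟩
      by_contra hcon
      exact hxu ⟨not_le.1 hcon, by linarith [hx.2]⟩
    · rw [measure_eq_zero_iff_ae_notMem]
      filter_upwards [hη] with x hx hxu
      have h1 : x ≤ u := hxu
      linarith [not_lt.1 hu, hx.1]
  filter_upwards [hae'] with u hu
  -- The atom of `scaleMeasure` at R turns almost-everywhere equality in s into equality at s = R.
  have hRmem : η₁ (Set.Ioo u (u + R)) = η₂ (Set.Ioo u (u + R)) := by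
    rw [scaleMeasure, ae_add_measure_iff] at hu
    have h3 := ae_iff.1 hu.2
    by_contra hne
    rw [Measure.smul_apply, Measure.dirac_apply_of_mem hne] at h3
    simp [hR] at h3
  rw [hIic η₁ inferInstance h₁, hIic η₂ inferInstance h₂, hRmem]

theorem measurable_shiftedKernel_right (R : ℝ) (z : ℂ) : Measurable (shiftedKernel R z) := by
  unfold shiftedKernel
  have h : Measurable (logKernel z) := by
    unfold logKernel
    fun_prop
  exact (h.add measurable_const).ereal_toENNReal

theorem lintegral_shiftedKernel_map (R : ℝ) (η : Measure ℝ) [SFinite η] :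
    ∫⁻ z, ∫⁻ w, shiftedKernel R z w ∂η.map Complex.ofReal ∂η.map Complex.ofReal =
      ∫⁻ x : ℝ, ∫⁻ y : ℝ, shiftedKernel R (x : ℂ) (y : ℂ) ∂η ∂η := by
  have hofReal : Measurable Complex.ofReal := Complex.measurable_ofReal
  simp_rw [lintegral_map (measurable_shiftedKernel_right R _) hofReal]
  refine lintegral_map (f := fun z => ∫⁻ y : ℝ, shiftedKernel R z (y : ℂ) ∂η) ?_ hofReal
  have : Measurable fun p : ℂ × ℝ => shiftedKernel R p.1 (p.2 : ℂ) :=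
    (measurable_shiftedKernel R).comp (g := fun p : ℂ × ℂ => shiftedKernel R p.1 p.2)
      (f := fun p : ℂ × ℝ => (p.1, (p.2 : ℂ))) (measurable_fst.prodMk (hofReal.comp measurable_snd))
  exact this.lintegral_prod_right'

theorem energy_eq_lintegral_sq {ρ : Measure ℂ} [IsProbabilityMeasure ρ] {R L : ℝ}
    (hR : 1 ≤ R) (hLR : 2 * L ≤ R)
    (hρ : ρ ((fun x : ℝ => (x : ℂ)) '' Set.Icc (-L) L)ᶜ = 0) :
    (∀ᵐ x ∂ρ.map Complex.re, x ∈ Set.Icc (-L) L) ∧ (ρ.map Complex.re).map Complex.ofReal = ρ ∧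
    energy ρ = ((∫⁻ ω, ρ.map Complex.re (Set.Ioo ω.1 (ω.1 + ω.2)) ^ 2
      ∂((volume : Measure ℝ).prod (scaleMeasure R)) : ℝ≥0∞) : EReal) - (Real.log R : EReal) := by
  have hre : Measurable Complex.re := Complex.measurable_re
  have hρ' : ∀ᵐ z ∂ρ, z ∈ (fun x : ℝ => (x : ℂ)) '' Set.Icc (-L) L := hρ
  have h1 : ∀ᵐ x ∂ρ.map Complex.re, x ∈ Set.Icc (-L) L := by
    refine (ae_map_iff (p := fun x => x ∈ Set.Icc (-L) L) hre.aemeasurable measurableSet_Icc).2 ?_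
    filter_upwards [hρ'] with z hz
    obtain ⟨x, hx, rfl⟩ := hz
    simpa using hx
  have h2 : (ρ.map Complex.re).map Complex.ofReal = ρ := by
    rw [Measure.map_map Complex.measurable_ofReal hre]
    conv_rhs => rw [← Measure.map_id (μ := ρ)]
    refine Measure.map_congr ?_
    filter_upwards [hρ'] with z hz
    obtain ⟨x, hx, rfl⟩ := hz
    simp
  have : IsProbabilityMeasure (ρ.map Complex.re) := Measure.isProbabilityMeasure_map hre.aemeasurable
  refine ⟨h1, h2, ?_⟩
  have h3 := lintegral_shiftedKernel_map R (ρ.map Complex.re)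
  rw [h2, lintegral_shiftedKernel_eq (one_pos.trans_le hR) hLR h1] at h3
  rw [← h3]
  refine energy_eq_lintegral_sub hR hρ ?_
  · rintro _ ⟨x, hx, rfl⟩ _ ⟨y, hy, rfl⟩
    simp only [← Complex.ofReal_sub, Complex.norm_real, Real.norm_eq_abs]
    rw [abs_le]
    constructor <;> linarith [hx.1, hx.2, hy.1, hy.2]

/-- Uniqueness of the equilibrium measure of a bounded subset of the real line. -/
theorem eq_of_isEquilibriumMeasure {E : Set ℂ} {L : ℝ}
    (hE : E ⊆ (fun x : ℝ => (x : ℂ)) '' Set.Icc (-L) L) (htop : minEnergy E ≠ ⊤)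
    {ρ₁ ρ₂ : ProbabilityMeasure ℂ} (h₁ : IsEquilibriumMeasure E ρ₁)
    (h₂ : IsEquilibriumMeasure E ρ₂) : ρ₁ = ρ₂ := by
  set R : ℝ := max 1 (2 * L + 1) with hRdef
  have hR : 1 ≤ R := le_max_left _ _
  have hLR : 2 * L < R := (lt_add_one _).trans_le (le_max_right _ _)
  have hsupp : ∀ ρ : ProbabilityMeasure ℂ, ρ ∈ probOn E →
      (ρ : Measure ℂ) ((fun x : ℝ => (x : ℂ)) '' Set.Icc (-L) L)ᶜ = 0 := fun ρ hρ =>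
    measure_mono_null (Set.compl_subset_compl.2 hE) hρ
  obtain ⟨a₁, b₁, c₁⟩ := energy_eq_lintegral_sq hR hLR.le (hsupp _ h₁.1)
  obtain ⟨a₂, b₂, c₂⟩ := energy_eq_lintegral_sq hR hLR.le (hsupp _ h₂.1)
  let mid : ProbabilityMeasure ℂ :=
    ⟨(2⁻¹ : ℝ≥0∞) • (ρ₁ : Measure ℂ) + (2⁻¹ : ℝ≥0∞) • (ρ₂ : Measure ℂ),
      ⟨by simp [ENNReal.inv_two_add_inv_two]⟩⟩
  have hmid : mid ∈ probOn E := by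
    have e₁ : (ρ₁ : Measure ℂ) Eᶜ = 0 := h₁.1
    have e₂ : (ρ₂ : Measure ℂ) Eᶜ = 0 := h₂.1
    change ((2⁻¹ : ℝ≥0∞) • (ρ₁ : Measure ℂ) + (2⁻¹ : ℝ≥0∞) • (ρ₂ : Measure ℂ)) Eᶜ = 0
    simp [e₁, e₂]
  obtain ⟨-, -, c⟩ := energy_eq_lintegral_sq hR hLR.le (hsupp _ hmid)
  have hmidmap : (mid : Measure ℂ).map Complex.re = (2⁻¹ : ℝ≥0∞) •
      (ρ₁ : Measure ℂ).map Complex.re + (2⁻¹ : ℝ≥0∞) • (ρ₂ : Measure ℂ).map Complex.re := by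
    change ((2⁻¹ : ℝ≥0∞) • (ρ₁ : Measure ℂ) + (2⁻¹ : ℝ≥0∞) • (ρ₂ : Measure ℂ)).map _ = _
    rw [Measure.map_add _ _ Complex.measurable_re, Measure.map_smul, Measure.map_smul]
  have hle : minEnergy E ≤ energy (mid : Measure ℂ) := iInf₂_le mid hmid
  have : IsProbabilityMeasure ((ρ₁ : Measure ℂ).map Complex.re) :=
    Measure.isProbabilityMeasure_map Complex.measurable_re.aemeasurable
  have : IsProbabilityMeasure ((ρ₂ : Measure ℂ).map Complex.re) :=
    Measure.isProbabilityMeasure_map Complex.measurable_re.aemeasurable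
  rw [c, hmidmap] at hle
  rw [h₁.2] at c₁
  rw [h₂.2] at c₂
  have hcancel : ∀ {a b : ℝ≥0∞}, (a : EReal) - (Real.log R : EReal) ≤ b - (Real.log R : EReal) →
      a ≤ b := by
    intro a b hab
    have h := add_le_add_left hab (Real.log R : EReal)
    rw [EReal.sub_add_cancel, EReal.sub_add_cancel] at h
    exact_mod_cast h
  have hη := measure_eq_of_le_midpoint (one_pos.trans_le hR) hLR a₁ a₂ ?_ rfl
    (le_antisymm (hcancel (c₂ ▸ c₁ ▸ le_rfl)) (hcancel (c₁ ▸ c₂ ▸ le_rfl)))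
    (hcancel (c₁ ▸ hle))
  · refine ProbabilityMeasure.toMeasure_injective ?_
    rw [← b₁, ← b₂, hη]
  · intro h
    rw [h] at c₁
    exact htop (c₁.trans (by simp))

end Uniqueness


/-! ### From a bound on the potential to a bound on the energy -/

section EnergyBound

/-- If the potential of a measure on a bounded real interval is at most `c` off the real line,
then so is its energy. -/
theorem energy_le_of_potential_le {ν : Measure ℂ} [IsProbabilityMeasure ν] {L c : ℝ}
    (hν : ν ((fun x : ℝ => (x : ℂ)) '' Set.Icc (-L) L)ᶜ = 0)
    (hpot : ∀ z : ℂ, z.im ≠ 0 → potential ν z ≤ (c : EReal)) : energy ν ≤ (c : EReal) := by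
  set K : Set ℂ := (fun x : ℝ => (x : ℂ)) '' Set.Icc (-L) L with hK
  set R : ℝ := max 1 (2 * L + 1) with hRdef
  have hR : 1 ≤ R := le_max_left _ _
  have hLR : 2 * L + 1 ≤ R := le_max_right _ _
  have hdist : ∀ z ∈ K, ∀ w ∈ K, ‖z - w‖ ≤ 2 * L := by
    rintro _ ⟨x, hx, rfl⟩ _ ⟨y, hy, rfl⟩
    simp only [← Complex.ofReal_sub, Complex.norm_real, Real.norm_eq_abs]
    rw [abs_le]
    constructor <;> linarith [hx.1, hx.2, hy.1, hy.2]
  have hνK : ∀ᵐ w ∂ν, w ∈ K := hν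
  let ε : ℕ → ℝ := fun k => 1 / ((k : ℝ) + 1)
  have hε0 : ∀ k, 0 < ε k := fun k => by positivity
  have hε1 : ∀ k, ε k ≤ 1 := fun k => by
    rw [div_le_one (by positivity)]
    linarith [(Nat.cast_nonneg k : (0 : ℝ) ≤ k)]
  have hεlim : Tendsto ε atTop (𝓝 0) := tendsto_one_div_add_atTop_nhds_zero_nat
  have hoff : ∀ z ∈ K, ∀ k, ((∫⁻ w, shiftedKernel R (z + ε k * Complex.I) w ∂ν : ℝ≥0∞) : EReal) ≤
      ((c + Real.log R : ℝ) : EReal) := by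
    intro z hz k
    have him : (z + ε k * Complex.I).im ≠ 0 := by
      obtain ⟨x, -, rfl⟩ := hz
      simpa using (hε0 k).ne'
    have hle : ∀ᵐ w ∂ν, ‖z + ε k * Complex.I - w‖ ≤ R := by
      filter_upwards [hνK] with w hw
      have h1 : z + ε k * Complex.I - w = (z - w) + ε k * Complex.I := by ring
      rw [h1]
      refine (norm_add_le _ _).trans ?_
      rw [norm_mul, Complex.norm_I, mul_one, Complex.norm_real, Real.norm_of_nonneg (hε0 k).le]
      linarith [hdist z hz w hw, hε1 k]
    have h2 := hpot _ him
    rw [potential_eq_lintegral_sub hR hle] at h2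
    have h3 := add_le_add_left h2 (Real.log R : EReal)
    rw [EReal.sub_add_cancel] at h3
    exact_mod_cast h3
  have hnn : 0 ≤ c + Real.log R := by
    obtain ⟨z, hz⟩ := hνK.exists
    exact_mod_cast (EReal.coe_ennreal_nonneg _).trans (hoff z hz 0)
  -- Fatou's lemma as z is approached vertically. The kernel is continuous into [0, ∞] even on the
  -- diagonal, and R leaves room for a shift of length at most 1.
  have hin : ∀ z ∈ K, ∫⁻ w, shiftedKernel R z w ∂ν ≤ ENNReal.ofReal (c + Real.log R) := by
    intro z hz
    have hlim : ∀ w, Tendsto (fun k => shiftedKernel R (z + ε k * Complex.I) w) atTop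
        (𝓝 (shiftedKernel R z w)) := by
      intro w
      have h1 : Tendsto (fun k => z + ε k * Complex.I) atTop (𝓝 z) := by
        have h2 : Tendsto (fun k => (ε k : ℂ)) atTop (𝓝 ((0 : ℝ) : ℂ)) :=
          (Complex.continuous_ofReal.tendsto 0).comp hεlim
        simpa using tendsto_const_nhds.add (h2.mul_const Complex.I)
      exact ((continuous_shiftedKernel (R := R) w).tendsto z).comp h1
    calc ∫⁻ w, shiftedKernel R z w ∂ν
        = ∫⁻ w, liminf (fun k => shiftedKernel R (z + ε k * Complex.I) w) atTop ∂ν :=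
          lintegral_congr fun w => (hlim w).liminf_eq.symm
      _ ≤ liminf (fun k => ∫⁻ w, shiftedKernel R (z + ε k * Complex.I) w ∂ν) atTop :=
          lintegral_liminf_le fun k => measurable_shiftedKernel_right R _
      _ ≤ liminf (fun _ : ℕ => ENNReal.ofReal (c + Real.log R)) atTop := by
          refine liminf_le_liminf (Eventually.of_forall fun k => ?_)
          have h1 := hoff z hz k
          rw [← EReal.coe_ennreal_le_coe_ennreal_iff, EReal.coe_ennreal_ofReal, max_eq_left hnn]
          exact h1
      _ = _ := by simp
  have hout : ∫⁻ z, ∫⁻ w, shiftedKernel R z w ∂ν ∂ν ≤ ENNReal.ofReal (c + Real.log R) := by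
    calc _ ≤ ∫⁻ _, ENNReal.ofReal (c + Real.log R) ∂ν := lintegral_mono_ae (hνK.mono hin)
      _ = _ := by simp
  rw [energy_eq_lintegral_sub hR hν fun z hz w hw => (hdist z hz w hw).trans (by linarith)]
  refine EReal.sub_le_of_le_add ?_
  rw [← EReal.coe_add, ← max_eq_left hnn, ← EReal.coe_ennreal_ofReal]
  exact_mod_cast hout

theorem minEnergy_ne_bot {E : Set ℂ} {L : ℝ}
    (hE : E ⊆ (fun x : ℝ => (x : ℂ)) '' Set.Icc (-L) L) : minEnergy E ≠ ⊥ := by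
  set R : ℝ := max 1 (2 * L) with hRdef
  have hle : ((-Real.log R : ℝ) : EReal) ≤ minEnergy E := by
    refine le_iInf₂ fun ρ hρ => ?_
    have h0 : (ρ : Measure ℂ) ((fun x : ℝ => (x : ℂ)) '' Set.Icc (-L) L)ᶜ = 0 :=
      measure_mono_null (Set.compl_subset_compl.2 hE) hρ
    rw [(energy_eq_lintegral_sq (le_max_left _ _) (le_max_right _ _) h0).2.2, sub_eq_add_neg,
      EReal.coe_neg]
    exact le_add_of_nonneg_left (EReal.coe_ennreal_nonneg _)
  intro h
  rw [h] at hle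
  simp at hle

theorem capacity_eq_exp {E : Set ℂ} {m : ℝ} (h : minEnergy E = (m : EReal)) :
    capacity E = Real.exp (-m) := by
  rw [capacity, h, ← EReal.coe_neg, EReal.exp_coe, ENNReal.toReal_ofReal (Real.exp_pos _).le]

end EnergyBound

/-! ### Comparison with capacity, and regular measures -/

section Subsequences

variable {μ : Measure ℝ} {n : ℕ → ℕ} {l : Filter ℕ} {ν : FiniteMeasure ℂ}

theorem le_capacity_and_eq_equilibriumMeasure [IsFiniteMeasure μ]
    [l.NeBot] (hcpt : IsCompact μ.support)
    (hinf : μ.support.Infinite) (hn : Tendsto n l atTop)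
    (hν : Tendsto (fun j => zeroCounting μ (n j)) l (𝓝 ν))
    {A : ℝ} (hA : Tendsto (fun j => jacobiMean μ (n j)) l (𝓝 A)) (hApos : 0 < A) :
    A ≤ capacity (essSupport μ) ∧ (A = capacity (essSupport μ) →
      ν = (equilibriumMeasure (essSupport μ)).toFiniteMeasure) := by
  obtain ⟨L, hL⟩ := hcpt.isBounded.exists_norm_le
  have hE : essSupport μ ⊆ (fun x : ℝ => (x : ℂ)) '' Set.Icc (-L) L := by
    rintro _ ⟨x, hx, rfl⟩
    exact ⟨x, abs_le.1 (hL x hx.1), rfl⟩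
  have hprob : IsProbabilityMeasure (ν : Measure ℂ) := ⟨measure_univ_weakLimit hn hν⟩
  have hνE := measure_compl_essSupport hcpt hinf hn hν
  have henergy : energy (ν : Measure ℂ) ≤ ((-Real.log A : ℝ) : EReal) := by
    refine energy_le_of_potential_le (measure_mono_null (Set.compl_subset_compl.2 hE) hνE)
      fun z hz => ?_
    have hzH : z ∉ suppHull μ := by
      rintro ⟨x, -, rfl⟩
      simp at hz
    obtain ⟨φ, hφ, -, hAφ⟩ := root_asymptotics hcpt hinf hn hν hA hApos hzH
    rw [hφ, EReal.coe_le_coe_iff]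
    have := (Real.log_lt_iff_lt_exp hApos).2 hAφ
    linarith
  let ν' : ProbabilityMeasure ℂ := ⟨ν, hprob⟩
  have hmem : ν' ∈ probOn (essSupport μ) := hνE
  have hmin : minEnergy (essSupport μ) ≤ energy (ν : Measure ℂ) := iInf₂_le ν' hmem
  have htop : minEnergy (essSupport μ) ≠ ⊤ :=
    ((hmin.trans henergy).trans_lt (EReal.coe_lt_top _)).ne
  obtain ⟨m, hm⟩ : ∃ m : ℝ, minEnergy (essSupport μ) = (m : EReal) :=
    ⟨_, (EReal.coe_toReal htop (minEnergy_ne_bot hE)).symm⟩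
  have hmA : m ≤ -Real.log A := by
    have := hmin.trans henergy
    rw [hm] at this
    exact_mod_cast this
  rw [capacity_eq_exp hm]
  refine ⟨(Real.log_le_iff_le_exp hApos).1 (by linarith), fun hAm => ?_⟩
  have hAm' : -Real.log A = m := by rw [hAm, Real.log_exp, neg_neg]
  have heq : IsEquilibriumMeasure (essSupport μ) ν' :=
    ⟨hmem, le_antisymm (henergy.trans (by rw [hm, hAm'])) hmin⟩
  -- The limit measure itself witnesses that a minimizer exists, so no separate existence theorem is
  -- needed.
  have heq' : IsEquilibriumMeasure (essSupport μ) (equilibriumMeasure (essSupport μ)) :=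
    Classical.epsilon_spec ⟨ν', heq⟩
  rw [← eq_of_isEquilibriumMeasure hE htop heq heq']
  rfl

/-- For a regular measure the zero counting measures converge to the equilibrium measure. -/
theorem tendsto_zeroCounting_of_isRegular [IsFiniteMeasure μ]
    (hcpt : IsCompact μ.support) (hinf : μ.support.Infinite)
    (hpos : 0 < capacity (essSupport μ)) (hreg : IsRegular μ) :
    Tendsto (zeroCounting μ) atTop
      (𝓝 (equilibriumMeasure (essSupport μ)).toFiniteMeasure) := by
  have hK := isCompact_setOfPred_finiteMeasure_le_of_isCompact 1 (isCompact_suppHull hcpt)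
  refine hK.tendsto_nhds_of_unique_mapClusterPt ?_ fun ν _ hclus => ?_
  · filter_upwards with n
    have hreal : ∀ s : Set ℂ, MeasurableSet s → ((zeroCounting μ n s : ℝ≥0) : ℝ) =
        (n : ℝ)⁻¹ * ((zeros μ n).map (s.indicator 1)).sum := fun s hs => by
      rw [← integral_zeroCounting, integral_indicator_one hs,
        FiniteMeasure.measureReal_eq_coe_coeFn]
    refine ⟨?_, ?_⟩
    · rw [FiniteMeasure.mass, ← NNReal.coe_le_coe, hreal _ MeasurableSet.univ]
      -- The mass is n⁻¹ n, which is 0 rather than 1 for n = 0; hence an inequality.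
      simpa [Multiset.map_const', card_zeros] using inv_mul_le_one
    · rw [← NNReal.coe_eq_zero, hreal _ (isCompact_suppHull hcpt).isClosed.measurableSet.compl]
      refine mul_eq_zero_of_right _ (Multiset.sum_eq_zero fun x hx => ?_)
      obtain ⟨z, hz, rfl⟩ := Multiset.mem_map.1 hx
      simp [mem_suppHull_of_mem_zeros hcpt hinf hz]
  · have hne : (atTop ⊓ comap (zeroCounting μ) (𝓝 ν)).NeBot := by
      rw [← map_neBot_iff (zeroCounting μ), Filter.push_pull, inf_comm]
      exact hclus
    exact (le_capacity_and_eq_equilibriumMeasure (n := id)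
      (l := atTop ⊓ comap (zeroCounting μ) (𝓝 ν)) hcpt hinf (tendsto_id.mono_left inf_le_left)
      (tendsto_comap.mono_left inf_le_right) (hreg.mono_left inf_le_left) hpos).2 rfl

end Subsequences

end OPRL

theorem theorem2p4 (μ : Measure ℝ) [IsFiniteMeasure μ]
    (hcpt : IsCompact μ.support) (hinf : μ.support.Infinite) :
    -- subsequences
    (∀ (n : ℕ → ℕ) (ν : FiniteMeasure ℂ) (A : ℝ), StrictMono n →
      Tendsto (fun j => OPRL.zeroCounting μ (n j)) atTop (𝓝 ν) →
      Tendsto (fun j => OPRL.jacobiMean μ (n j)) atTop (𝓝 A) → 0 < A →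
        (∀ z : ℂ, z ∉ OPRL.suppHull μ → ∃ φ : ℝ, OPRL.potential (ν : Measure ℂ) z = (φ : EReal) ∧
          Tendsto (fun j => ‖aeval z (OPRL.orthonormalP μ (n j))‖ ^ (1 / (n j : ℝ))) atTop
            (𝓝 (A⁻¹ * Real.exp (-φ))) ∧
          A < Real.exp (-φ)) ∧
        A ≤ OPRL.capacity (OPRL.essSupport μ) ∧
        (A = OPRL.capacity (OPRL.essSupport μ) →
          ν = (OPRL.equilibriumMeasure (OPRL.essSupport μ)).toFiniteMeasure)) ∧
    -- regular measures
    (0 < OPRL.capacity (OPRL.essSupport μ) → OPRL.IsRegular μ →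
      Tendsto (OPRL.zeroCounting μ) atTop
        (𝓝 (OPRL.equilibriumMeasure (OPRL.essSupport μ)).toFiniteMeasure) ∧
      ∀ z : ℂ, z ∉ OPRL.suppHull μ → ∃ g : ℝ,
        OPRL.greenFunction (OPRL.essSupport μ) z = (g : EReal) ∧
        Tendsto (fun n : ℕ => ‖aeval z (OPRL.orthonormalP μ n)‖ ^ (1 / (n : ℝ))) atTop
          (𝓝 (Real.exp g))) := by
  refine ⟨fun n ν A hn hν hA hApos => ⟨fun z hz => ?_, ?_⟩, fun hpos hreg => ?_⟩
  · exact OPRL.root_asymptotics hcpt hinf hn.tendsto_atTop hν hA hApos hz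
  · exact OPRL.le_capacity_and_eq_equilibriumMeasure hcpt hinf hn.tendsto_atTop hν hA hApos
  · have hν := OPRL.tendsto_zeroCounting_of_isRegular hcpt hinf hpos hreg
    refine ⟨hν, fun z hz => ?_⟩
    obtain ⟨φ, hφ, hlim, -⟩ := OPRL.root_asymptotics (n := id) hcpt hinf tendsto_id hν hreg hpos hz
    refine ⟨-φ + Real.log (OPRL.capacity (OPRL.essSupport μ))⁻¹, ?_, ?_⟩
    · have hφ' : OPRL.potential (OPRL.equilibriumMeasure (OPRL.essSupport μ) : Measure ℂ) z =
        (φ : EReal) := hφ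
      rw [OPRL.greenFunction, hφ']
      push_cast
      rfl
    · rw [Real.exp_add, Real.exp_log (inv_pos.2 hpos), mul_comm]
      exact hlim
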